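/- Let $\Lambda=\mathbb Z+i\mathbb Z$, write $m_1=\operatorname{Re}m$, $m_2=\operatorname{Im}m$ for $m\in\Lambda$, and let $S_0=(0,1)\times(0,1)\subset\mathbb C$. Let the periodic cell $\varpi\subset S_0$ be a domain (nonempty, open, connected) such that $\partial S_0\subset\partial\varpi$ and $S_0\setminus\overline{\varpi}$ contains a nonempty open set. Put $\varpi_m=\varpi+m$, and let $\Omega$ be the interior of $\bigcup_{m\in\Lambda}\overline{\varpi_m}$. Assume that $\Omega\setminus\bigcup_{m}\varpi_m$ has area zero, and that $\Omega$ satisfies the following condition. $(\mathcal A)$ There is an elliptic function $\varphi$ with $\varphi(z)=\varphi(z+1)=\varphi(z+i)$, all of whose zeros lie in $\mathbb C\setminus\overline\Omega$, and a meromorphic function $\phi$ on $\mathbb C$ with only finitely many poles, all in $S_0$, such that $\varphi(z)=\sum_{m\in\Lambda}\phi(z-m)$ for all $z$ outside the $\Lambda$-translates of the poles of $\phi$, and $\sup_{z\in\Omega\setminus\overline{S_0}}(1+|z|)^b|\phi(z)|<\infty$ for some $b>2$. For open $D\subset\mathbb C$ let $A^2(D)$ be the subspace of analytic functions in $L^2(D)$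 (area measure), and let $\mathbf Q=[-\pi,\pi]^2$. For $\eta=(\eta_1,\eta_2)\in\mathbf Q$ let $A^2_{\eta,\mathrm{ext}}(\varpi)$ be the space of those $f\in A^2(\varpi)$ that extend analytically to an open set $U$ with $\overline\varpi\cap\Omega\subset U\subset\Omega$ in such a way that the extension satisfies $f(1+iy)=e^{i\eta_1}f(iy)$ for all $y\in(0,1)$ with $iy\in\Omega$, and $f(x+i)=e^{i\eta_2}f(x)$ for all $x\in(0,1)$ with $x\in\Omega$. Let $A^2_\eta(\varpi)$ be the closure of $A^2_{\eta,\mathrm{ext}}(\varpi)$ in $A^2(\varpi)$, and let $L^2(\mathbf Q;A^2_\eta(\varpi))$ be the subspace of the Bochner space $L^2(\mathbf Q;L^2(\varpi))$ of those $g$ with $g(\cdot,\eta)\in A^2_\eta(\varpi)$ for a.e. $\eta\in\mathbf Q$. Then the Floquet transform $$\mathsf Ff(z,\eta)=\frac1{2\pi}\sum_{m\in\Lambda}e^{-i\eta_1m_1-i\eta_2m_2}f(z+m),\qquad z\in\varpi,\ \eta\in\mathbf Q,$$ where the series converges unconditionally in $L^2(\mathbf Q;L^2(\varpi))$ for each $f\in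 A^2(\Omega)$, is a unitary operator from $A^2(\Omega)$ onto $L^2(\mathbf Q;A^2_\eta(\varpi))$. Its inverse is given, for $g\in L^2(\mathbf Q;A^2_\eta(\varpi))$, by $$\mathsf F^{-1}g(z)=\frac1{2\pi}\int_{\mathbf Q}e^{i[\operatorname{Re}z]\eta_1+i[\operatorname{Im}z]\eta_2}\,g\bigl(z-[\operatorname{Re}z]-i[\operatorname{Im}z],\eta\bigr)\,d\eta$$ for every $z\in\Omega$ with $z-[\operatorname{Re}z]-i[\operatorname{Im}z]\in\varpi$ (hence for a.e. $z\in\Omega$). Here $[x]$ is the largest integer not larger than $x$, the analytic representatives of $\mathsf F^{-1}g$ and of $g(\cdot,\eta)$ are used, and the integrand is absolutely integrable over $\mathbf Q$. -/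

import Mathlib

open MeasureTheory Complex Set
open scoped ENNReal

noncomputable section

namespace DoublyPeriodic

/-- The point `m₁ + i m₂` of the lattice `Λ = ℤ + iℤ` with index `m = (m₁, m₂)`. -/
def latticePt (m : ℤ × ℤ) : ℂ := (m.1 : ℂ) + (m.2 : ℂ) * I

/-- The open unit square `(0,1) × (0,1)`. -/
def unitSquare : Set ℂ := {z | z.re ∈ Ioo (0 : ℝ) 1 ∧ z.im ∈ Ioo (0 : ℝ) 1}

/-- The translate `ϖ + m` of a set. -/
def cellTranslate (ϖ : Set ℂ) (m : ℤ × ℤ) : Set ℂ := (fun z => z + latticePt m) '' ϖ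

/-- Periodic cells: domains inside the open unit square whose boundary contains the boundary of
the square and whose closure omits a nonempty open part of the square. -/
structure IsPeriodicCell (ϖ : Set ℂ) : Prop where
  isOpen : IsOpen ϖ
  isConnected : IsConnected ϖ
  subset_square : ϖ ⊆ unitSquare
  frontier_subset : frontier unitSquare ⊆ frontier ϖ
  exists_hole : ∃ V : Set ℂ, IsOpen V ∧ V.Nonempty ∧ V ⊆ unitSquare \ closure ϖ

/-- The doubly periodic domain generated by the cell `ϖ`: the interior of the union of the
closures of all its lattice translates. -/
def periodicDomain (ϖ : Set ℂ) : Set ℂ := interior (⋃ m : ℤ × ℤ, closure (cellTranslate ϖ m))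

/-- The poles of a meromorphic function. -/
def poles (f : ℂ → ℂ) : Set ℂ := {z | meromorphicOrderAt f z < 0}

/-- Condition `(𝒜)` on a doubly periodic domain `Ω`. Meromorphic functions on the plane are
represented by functions in normal form: analytic off the poles, and with value `0` at poles. -/
def ConditionA (Ω : Set ℂ) : Prop :=
  ∃ φ ϕ : ℂ → ℂ,
    -- `φ` is elliptic with periods `1` and `i`
    MeromorphicNFOn φ univ ∧ (∀ z, φ (z + 1) = φ z) ∧ (∀ z, φ (z + I) = φ z) ∧
    -- all zeros of `φ` are outside the closure of `Ω`
    (∀ z, 0 < meromorphicOrderAt φ z → z ∉ closure Ω) ∧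
    -- `ϕ` is meromorphic with finitely many poles, all of them in the open unit square
    MeromorphicNFOn ϕ univ ∧ (poles ϕ).Finite ∧ poles ϕ ⊆ unitSquare ∧
    -- `φ` is the sum of the lattice translates of `ϕ`
    (∀ z, (∀ m, z - latticePt m ∉ poles ϕ) →
      HasSum (fun m : ℤ × ℤ => ϕ (z - latticePt m)) (φ z)) ∧
    -- decay of `ϕ`
    ∃ b : ℝ, 2 < b ∧ ∃ d : ℝ, ∀ z ∈ Ω \ closure unitSquare, (1 + ‖z‖) ^ b * ‖ϕ z‖ ≤ d

/-- `L²(D)` with respect to the area measure. -/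
abbrev L2 (D : Set ℂ) : Type := Lp ℂ 2 (volume.restrict D : Measure ℂ)

/-- The Bergman space `A²(D)` of an open set `D`, as a subspace of `L²(D)`. -/
def bergmanSpace (D : Set ℂ) : Submodule ℂ (L2 D) where
  carrier := {f | ∃ G : ℂ → ℂ, DifferentiableOn ℂ G D ∧ f =ᵐ[volume.restrict D] G}
  zero_mem' := ⟨0, differentiableOn_const 0, Lp.coeFn_zero _ _ _⟩
  add_mem' := by
    rintro f g ⟨F, hF, hf⟩ ⟨G, hG, hg⟩
    exact ⟨F + G, hF.add hG, (Lp.coeFn_add f g).trans (hf.add hg)⟩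
  smul_mem' := by
    rintro c f ⟨F, hF, hf⟩
    exact ⟨c • F, hF.const_smul c, (Lp.coeFn_smul c f).trans (hf.const_smul c)⟩

open Classical in
/-- The analytic representative of an element of the Bergman space (and `0` for other elements of
`L²(D)`). For open `D` its values at the points of `D` are uniquely determined. -/
def analyticRep (D : Set ℂ) (f : L2 D) : ℂ → ℂ :=
  if h : f ∈ bergmanSpace D then h.choose else 0

/-- The space `A²_{η,ext}(ϖ)` of Bergman functions on the cell that extend analytically to a
neighbourhood (in `Ω`) of `closure ϖ ∩ Ω` and whose extension satisfies the `η`-quasiperiodic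
boundary conditions at the boundary points of the square that belong to `Ω`. -/
def bergmanExt (ϖ : Set ℂ) (η : ℝ × ℝ) : Submodule ℂ (L2 ϖ) where
  carrier := {f | f ∈ bergmanSpace ϖ ∧ ∃ (U : Set ℂ) (G : ℂ → ℂ),
    IsOpen U ∧ closure ϖ ∩ periodicDomain ϖ ⊆ U ∧ U ⊆ periodicDomain ϖ ∧
    DifferentiableOn ℂ G U ∧ f =ᵐ[volume.restrict ϖ] G ∧
    (∀ y ∈ Ioo (0 : ℝ) 1, (y : ℂ) * I ∈ periodicDomain ϖ →
      G (1 + (y : ℂ) * I) = exp ((η.1 : ℂ) * I) * G ((y : ℂ) * I)) ∧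
    (∀ x ∈ Ioo (0 : ℝ) 1, (x : ℂ) ∈ periodicDomain ϖ →
      G ((x : ℂ) + I) = exp ((η.2 : ℂ) * I) * G (x : ℂ))}
  zero_mem' := ⟨zero_mem _, periodicDomain ϖ, 0, isOpen_interior, inter_subset_right,
    subset_rfl, differentiableOn_const 0, Lp.coeFn_zero _ _ _, by simp, by simp⟩
  add_mem' := by
    rintro f g ⟨hf0, U, F, hU, hU1, hU2, hF, hf, h1, h2⟩ ⟨hg0, V, G, hV, hV1, hV2, hG, hg, k1, k2⟩
    refine ⟨add_mem hf0 hg0, U ∩ V, F + G, hU.inter hV, subset_inter hU1 hV1,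
      inter_subset_left.trans hU2, (hF.mono inter_subset_left).add (hG.mono inter_subset_right),
      (Lp.coeFn_add f g).trans (hf.add hg), fun y hy hy' => ?_, fun x hx hx' => ?_⟩
    · simp only [Pi.add_apply, h1 y hy hy', k1 y hy hy', mul_add]
    · simp only [Pi.add_apply, h2 x hx hx', k2 x hx hx', mul_add]
  smul_mem' := by
    rintro c f ⟨hf0, U, F, hU, hU1, hU2, hF, hf, h1, h2⟩
    refine ⟨Submodule.smul_mem _ c hf0, U, c • F, hU, hU1, hU2, hF.const_smul c,
      (Lp.coeFn_smul c f).trans (hf.const_smul c), fun y hy hy' => ?_, fun x hx hx' => ?_⟩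
    · simp only [Pi.smul_apply, h1 y hy hy', smul_eq_mul]; ring
    · simp only [Pi.smul_apply, h2 x hx hx', smul_eq_mul]; ring

/-- The space `A²_η(ϖ)`: the closure of `A²_{η,ext}(ϖ)` in `A²(ϖ)`. -/
def bergmanEta (ϖ : Set ℂ) (η : ℝ × ℝ) : Submodule ℂ (L2 ϖ) :=
  (bergmanExt ϖ η).topologicalClosure ⊓ bergmanSpace ϖ

/-- The square `[-π,π]²` of Floquet parameters. -/
def floquetBox : Set (ℝ × ℝ) := Icc (-Real.pi) Real.pi ×ˢ Icc (-Real.pi) Real.pi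

/-- The Bochner space `L²([-π,π]²; L²(ϖ))`. -/
abbrev BochnerL2 (ϖ : Set ℂ) : Type := Lp (L2 ϖ) 2 (volume.restrict floquetBox)

/-- The subspace `L²([-π,π]²; A²_η(ϖ))` of those `g` in `L²([-π,π]²; L²(ϖ))` for which
`g(·, η)` belongs to `A²_η(ϖ)` for almost every `η`. -/
def bochnerBergman (ϖ : Set ℂ) : Submodule ℂ (BochnerL2 ϖ) where
  carrier := {g | ∀ᵐ η ∂(volume.restrict floquetBox), g η ∈ bergmanEta ϖ η}
  zero_mem' := by
    filter_upwards [Lp.coeFn_zero (L2 ϖ) 2 (volume.restrict floquetBox)] with η h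
    rw [h]; exact zero_mem _
  add_mem' := by
    intro f g hf hg
    filter_upwards [hf, hg, Lp.coeFn_add f g] with η h1 h2 h
    rw [h]; exact add_mem h1 h2
  smul_mem' := by
    intro c f hf
    filter_upwards [hf, Lp.coeFn_smul c f] with η h1 h
    rw [h]; exact Submodule.smul_mem _ c h1

/-- The phase `η₁ m₁ + η₂ m₂`. -/
def phase (η : ℝ × ℝ) (m : ℤ × ℤ) : ℝ := η.1 * m.1 + η.2 * m.2

lemma IsPeriodicCell.translate_subset {ϖ : Set ℂ} (h : IsPeriodicCell ϖ) (m : ℤ × ℤ) :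
    cellTranslate ϖ m ⊆ periodicDomain ϖ := by
  refine interior_maximal ?_ ((isOpenMap_add_right (latticePt m)) ϖ h.isOpen)
  exact subset_closure.trans (subset_iUnion (fun k => closure (cellTranslate ϖ k)) m)

lemma IsPeriodicCell.memLp_shift {ϖ : Set ℂ} (h : IsPeriodicCell ϖ) (m : ℤ × ℤ)
    (f : L2 (periodicDomain ϖ)) :
    MemLp (fun z => f (z + latticePt m)) 2 (volume.restrict ϖ) := by
  have hmp : MeasurePreserving (fun z : ℂ => z + latticePt m) (volume.restrict ϖ)
      (volume.restrict (cellTranslate ϖ m)) :=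
    (measurePreserving_add_right volume (latticePt m)).restrict_image_emb
      (measurableEmbedding_addRight (latticePt m)) ϖ
  exact ((Lp.memLp f).mono_measure
    (Measure.restrict_mono (h.translate_subset m) le_rfl)).comp_measurePreserving hmp

/-- The element `z ↦ f(z + m)` of `L²(ϖ)`, for `f` in `L²(Ω)`. -/
def shift {ϖ : Set ℂ} (h : IsPeriodicCell ϖ) (m : ℤ × ℤ) (f : L2 (periodicDomain ϖ)) : L2 ϖ :=
  (h.memLp_shift m f).toLp _

lemma memLp_term {ϖ : Set ℂ} (m : ℤ × ℤ) (v : L2 ϖ) :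
    MemLp (fun η : ℝ × ℝ => ((1 / (2 * Real.pi) : ℂ) * exp (-(phase η m : ℂ) * I)) • v) 2
      (volume.restrict floquetBox) := by
  have hfin : IsFiniteMeasure (volume.restrict floquetBox : Measure (ℝ × ℝ)) :=
    ⟨by
      rw [Measure.restrict_apply_univ]
      exact ((isCompact_Icc (a := -Real.pi) (b := Real.pi)).prod
        (isCompact_Icc (a := -Real.pi) (b := Real.pi))).measure_lt_top⟩
  have hc : Continuous
      (fun η : ℝ × ℝ => ((1 / (2 * Real.pi) : ℂ) * exp (-(phase η m : ℂ) * I)) • v) := by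
    unfold phase; fun_prop
  refine MemLp.of_bound hc.aestronglyMeasurable (‖(1 / (2 * Real.pi) : ℂ)‖ * ‖v‖)
    (Filter.Eventually.of_forall fun η => ?_)
  rw [norm_smul, norm_mul, ← ofReal_neg, norm_exp_ofReal_mul_I, mul_one]

/-- The `m`-th term `(2π)⁻¹ e^{-i η₁ m₁ - i η₂ m₂} f(z + m)` of the Floquet series of `f`, as an
element of `L²([-π,π]²; L²(ϖ))`. -/
def floquetTerm {ϖ : Set ℂ} (h : IsPeriodicCell ϖ) (f : L2 (periodicDomain ϖ)) (m : ℤ × ℤ) :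
    BochnerL2 ϖ :=
  (memLp_term m (shift h m f)).toLp _

/-- The index `([Re z], [Im z])`. -/
def floorIdx (z : ℂ) : ℤ × ℤ := (⌊z.re⌋, ⌊z.im⌋)

end DoublyPeriodic

end

open DoublyPeriodic

open MeasureTheory Complex Set DoublyPeriodic
open scoped ENNReal

namespace DoublyPeriodic

/-! ### Translation operators between `L²` spaces -/

/-! Isometry. The normalised characters are orthonormal on the parameter square, so the terms of the
Floquet series lie in mutually orthogonal copies of `L2 ϖ` (`orthogonalFamily_termL`). Up to a null
set `Ω` is the disjoint union of the translates of the cell, so the squared norms of the terms add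
up to that of `f` (`hasSum_norm_sq_shift`). This gives unconditional convergence and norm
preservation.

Range. The same series converges in `L²` of a neighbourhood of the closed cell in `Ω`. Its fibres
are analytic there because the Bergman space is closed, and reindexing the sum gives
quasiperiodicity. So almost every fibre already lies in `bergmanExt`, before taking closures
(`ae_tsum_floquetTerm_mem_bergmanExt`).

Surjectivity. Condition (𝒜) enters here. The quotient `ψ = ϕ / φ`, with its singularities removed,
is analytic on `Ω`, decays summably, and its lattice translates sum to 1
(`exists_analytic_partition`). Given `v` in `bergmanExt ϖ η`, let `E` be its quasiperiodic extension
to `Ω`. Then `E ψ` is a Bergman function whose Floquet series has absolutely summable norms. Its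
transform is therefore continuous in the parameter, with value `v / (2π)` at `η`
(`exists_hasSum_shift_of_mem_bergmanExt`). Let `g` be orthogonal to the range. The range is
invariant under multiplication by characters, so for each continuous transform `Φ` all Fourier
coefficients of `⟨Φ(η), g(η)⟩` vanish, and this function is zero almost everywhere. Separability of
the space of continuous maps makes the exceptional null set independent of `Φ`. Hence almost every
`g(η)` is orthogonal to `bergmanExt ϖ η`; if it also lies in the closure, it is zero
(`eq_zero_of_mem_orthogonal`). No measurable selection in `η` is needed.

Inversion. Evaluation at a point of the cell is a disc average, a bounded functional on `L2 ϖ`.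
Applied to the translates of `f`, it turns the formula into one for Fourier coefficients
(`apply_shift_eq_integral`). -/

lemma quasiMeasurePreserving_translate {D D' : Set ℂ} {k : ℂ} (h : ∀ z ∈ D', z + k ∈ D) :
    Measure.QuasiMeasurePreserving (fun z : ℂ => z + k) (volume.restrict D')
      (volume.restrict D) := by
  have hmp : MeasurePreserving (fun z : ℂ => z + k) (volume.restrict D')
      (volume.restrict ((fun z : ℂ => z + k) '' D')) :=
    (measurePreserving_add_right volume k).restrict_image_emb (measurableEmbedding_addRight k) D'
  refine hmp.quasiMeasurePreserving.mono_right ?_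
  exact (Measure.restrict_mono (image_subset_iff.2 h) le_rfl).absolutelyContinuous

lemma eLpNorm_translate_le {D D' : Set ℂ} {k : ℂ} (h : ∀ z ∈ D', z + k ∈ D) {f : ℂ → ℂ}
    (hf : AEStronglyMeasurable f (volume.restrict D)) :
    eLpNorm (fun z => f (z + k)) 2 (volume.restrict D') ≤ eLpNorm f 2 (volume.restrict D) := by
  have hmp : MeasurePreserving (fun z : ℂ => z + k) (volume.restrict D')
      (volume.restrict ((fun z : ℂ => z + k) '' D')) :=
    (measurePreserving_add_right volume k).restrict_image_emb (measurableEmbedding_addRight k) D'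
  have hle : (volume.restrict ((fun z : ℂ => z + k) '' D') : Measure ℂ) ≤ volume.restrict D :=
    Measure.restrict_mono (image_subset_iff.2 h) le_rfl
  rw [← Function.comp_def f, eLpNorm_comp_measurePreserving (hf.mono_measure hle) hmp]
  exact eLpNorm_mono_measure _ hle

lemma memLp_translate {D D' : Set ℂ} {k : ℂ} (h : ∀ z ∈ D', z + k ∈ D) {f : ℂ → ℂ}
    (hf : MemLp f 2 (volume.restrict D)) : MemLp (fun z => f (z + k)) 2 (volume.restrict D') :=
  ⟨hf.1.comp_quasiMeasurePreserving (quasiMeasurePreserving_translate h),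
    (eLpNorm_translate_le h hf.1).trans_lt hf.2⟩

/-- Translation `f ↦ f(· + k)`, from `L²` of a set to `L²` of a set whose translate it contains. -/
noncomputable def translateL {D D' : Set ℂ} (k : ℂ) (h : ∀ z ∈ D', z + k ∈ D) :
    L2 D →L[ℂ] L2 D' :=
  LinearMap.mkContinuous
    { toFun := fun f => (memLp_translate h (Lp.memLp f)).toLp _
      map_add' := fun f g => by
        rw [← MemLp.toLp_add]
        exact MemLp.toLp_congr _ _
          ((quasiMeasurePreserving_translate h).ae_eq_comp (Lp.coeFn_add f g))
      map_smul' := fun c f => by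
        rw [RingHom.id_apply, ← MemLp.toLp_const_smul]
        exact MemLp.toLp_congr _ _
          ((quasiMeasurePreserving_translate h).ae_eq_comp (Lp.coeFn_smul c f)) }
    1 (fun f => by
      rw [one_mul, LinearMap.coe_mk, AddHom.coe_mk, Lp.norm_toLp, Lp.norm_def]
      exact ENNReal.toReal_mono (Lp.memLp f).2.ne (eLpNorm_translate_le h (Lp.memLp f).1))

lemma coeFn_translateL {D D' : Set ℂ} {k : ℂ} (h : ∀ z ∈ D', z + k ∈ D) (f : L2 D) :
    translateL k h f =ᵐ[volume.restrict D'] fun z => f (z + k) :=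
  (memLp_translate h (Lp.memLp f)).coeFn_toLp

lemma translateL_congr {D D' : Set ℂ} {k : ℂ} (h : ∀ z ∈ D', z + k ∈ D) {f : L2 D} {G : ℂ → ℂ}
    (hf : f =ᵐ[volume.restrict D] G) :
    translateL k h f =ᵐ[volume.restrict D'] fun z => G (z + k) :=
  (coeFn_translateL h f).trans ((quasiMeasurePreserving_translate h).ae_eq_comp hf)

lemma translateL_translateL {D D' D'' : Set ℂ} {k l m : ℂ} (h : ∀ z ∈ D', z + k ∈ D)
    (h' : ∀ z ∈ D'', z + l ∈ D') (h'' : ∀ z ∈ D'', z + m ∈ D) (hm : m = l + k) (f : L2 D) :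
    translateL l h' (translateL k h f) = translateL m h'' f := by
  refine Lp.ext ?_
  refine (translateL_congr h' (coeFn_translateL h f)).trans ?_
  refine Filter.EventuallyEq.trans ?_ (coeFn_translateL h'' f).symm
  exact .of_forall fun _ => by simp only [hm, add_assoc]

lemma translateL_mem_bergmanSpace {D D' : Set ℂ} {k : ℂ} (h : ∀ z ∈ D', z + k ∈ D) {f : L2 D}
    (hf : f ∈ bergmanSpace D) : translateL k h f ∈ bergmanSpace D' := by
  obtain ⟨G, hG, hfG⟩ := hf
  exact ⟨fun z => G (z + k), hG.comp (by fun_prop) h, translateL_congr h hfG⟩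

lemma shift_eq_translateL {ϖ : Set ℂ} (h : IsPeriodicCell ϖ) (m : ℤ × ℤ)
    (f : L2 (periodicDomain ϖ)) :
    shift h m f = translateL (latticePt m)
      (fun _ hz => h.translate_subset m (mem_image_of_mem _ hz)) f := rfl

/-! ### The lattice and the periodic domain -/

@[simp] lemma latticePt_zero : latticePt 0 = 0 := by simp [latticePt]

lemma latticePt_add (m n : ℤ × ℤ) : latticePt (m + n) = latticePt m + latticePt n := by
  simp only [latticePt, Prod.fst_add, Prod.snd_add]; push_cast; ring

lemma latticePt_neg (m : ℤ × ℤ) : latticePt (-m) = -latticePt m := by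
  simp only [latticePt, Prod.fst_neg, Prod.snd_neg]; push_cast; ring

@[simp] lemma latticePt_re (m : ℤ × ℤ) : (latticePt m).re = m.1 := by simp [latticePt]

@[simp] lemma latticePt_im (m : ℤ × ℤ) : (latticePt m).im = m.2 := by simp [latticePt]

lemma floorIdx_add (z : ℂ) (m : ℤ × ℤ) : floorIdx (z + latticePt m) = floorIdx z + m := by
  ext <;> simp [floorIdx]

lemma floorIdx_of_mem_unitSquare {z : ℂ} (hz : z ∈ unitSquare) : floorIdx z = 0 := by
  obtain ⟨⟨h1, h2⟩, h3, h4⟩ := hz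
  ext <;> simp only [floorIdx, Prod.fst_zero, Prod.snd_zero, Int.floor_eq_zero_iff]
  · exact ⟨h1.le, h2⟩
  · exact ⟨h3.le, h4⟩

lemma floorIdx_add_of_mem_unitSquare {z : ℂ} (hz : z ∈ unitSquare) (m : ℤ × ℤ) :
    floorIdx (z + latticePt m) = m := by
  rw [floorIdx_add, floorIdx_of_mem_unitSquare hz, zero_add]

lemma mem_cellTranslate {ϖ : Set ℂ} {m : ℤ × ℤ} {z : ℂ} :
    z ∈ cellTranslate ϖ m ↔ z - latticePt m ∈ ϖ :=
  ⟨by rintro ⟨w, hw, rfl⟩; simpa using hw, fun h => ⟨_, h, by simp⟩⟩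

lemma closure_cellTranslate (ϖ : Set ℂ) (m : ℤ × ℤ) :
    closure (cellTranslate ϖ m) = cellTranslate (closure ϖ) m :=
  ((Homeomorph.addRight (latticePt m)).image_closure ϖ).symm

lemma mem_iUnion_closure_add {ϖ : Set ℂ} {z : ℂ} (m : ℤ × ℤ)
    (hz : z ∈ ⋃ m : ℤ × ℤ, closure (cellTranslate ϖ m)) :
    z + latticePt m ∈ ⋃ m : ℤ × ℤ, closure (cellTranslate ϖ m) := by
  obtain ⟨k, hk⟩ := mem_iUnion.1 hz
  refine mem_iUnion.2 ⟨k + m, ?_⟩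
  rw [closure_cellTranslate, mem_cellTranslate] at hk ⊢
  simpa [latticePt_add] using hk

lemma isOpen_periodicDomain (ϖ : Set ℂ) : IsOpen (periodicDomain ϖ) := isOpen_interior

lemma add_mem_periodicDomain {ϖ : Set ℂ} {z : ℂ} (m : ℤ × ℤ) (hz : z ∈ periodicDomain ϖ) :
    z + latticePt m ∈ periodicDomain ϖ := by
  have h : (fun w => w + latticePt m) '' periodicDomain ϖ ⊆ periodicDomain ϖ := by
    refine interior_maximal ?_ (isOpenMap_add_right (latticePt m) _ isOpen_interior)
    rintro _ ⟨w, hw, rfl⟩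
    exact mem_iUnion_closure_add m (interior_subset hw)
  exact h (mem_image_of_mem _ hz)

lemma sub_mem_periodicDomain {ϖ : Set ℂ} {z : ℂ} (m : ℤ × ℤ) (hz : z ∈ periodicDomain ϖ) :
    z - latticePt m ∈ periodicDomain ϖ := by
  simpa [latticePt_neg, sub_eq_add_neg] using add_mem_periodicDomain (-m) hz

lemma IsPeriodicCell.subset_periodicDomain {ϖ : Set ℂ} (h : IsPeriodicCell ϖ) :
    ϖ ⊆ periodicDomain ϖ := fun z hz =>
  h.translate_subset 0 (mem_cellTranslate.2 (by simpa using hz))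

lemma unitSquare_eq : unitSquare = Ioo (0 : ℝ) 1 ×ℂ Ioo (0 : ℝ) 1 := rfl

lemma isOpen_unitSquare : IsOpen unitSquare := isOpen_Ioo.reProdIm isOpen_Ioo

lemma closure_unitSquare : closure unitSquare = Icc (0 : ℝ) 1 ×ℂ Icc (0 : ℝ) 1 := by
  rw [unitSquare_eq, closure_reProdIm, closure_Ioo zero_ne_one]

lemma mem_closure_unitSquare {z : ℂ} :
    z ∈ closure unitSquare ↔ z.re ∈ Icc (0 : ℝ) 1 ∧ z.im ∈ Icc (0 : ℝ) 1 := by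
  rw [closure_unitSquare]; exact mem_reProdIm

lemma pairwise_disjoint_cellTranslate {ϖ : Set ℂ} (h : IsPeriodicCell ϖ) :
    Pairwise (Function.onFun Disjoint (cellTranslate ϖ)) := by
  intro m n hmn
  refine disjoint_left.2 fun z hm hn => hmn ?_
  have key : ∀ k, z ∈ cellTranslate ϖ k → floorIdx z = k := by
    rintro k ⟨w, hw, rfl⟩
    exact floorIdx_add_of_mem_unitSquare (h.subset_square hw) k
  rw [← key m hm, ← key n hn]

lemma add_notMem_closure_unitSquare {z : ℂ} (hz : z ∈ unitSquare) {m : ℤ × ℤ} (hm : m ≠ 0) :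
    z + latticePt m ∉ closure unitSquare := by
  intro h
  rw [mem_closure_unitSquare] at h
  simp only [add_re, add_im, latticePt_re, latticePt_im, mem_Icc] at h
  obtain ⟨⟨h1, h2⟩, h3, h4⟩ := hz
  obtain ⟨⟨k1, k2⟩, k3, k4⟩ := h
  have a1 : (-1 : ℝ) < m.1 := by linarith
  have a2 : (m.1 : ℝ) < 1 := by linarith
  have a3 : (-1 : ℝ) < m.2 := by linarith
  have a4 : (m.2 : ℝ) < 1 := by linarith
  norm_cast at a1 a2 a3 a4
  exact hm (Prod.ext (by simp; omega) (by simp; omega))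

/-- The part of the closed unit square in `Ω` lies in the closure of the cell. -/
lemma IsPeriodicCell.mem_closure {ϖ : Set ℂ} (h : IsPeriodicCell ϖ) {z : ℂ}
    (hz : z ∈ periodicDomain ϖ) (hz' : z ∈ closure unitSquare) : z ∈ closure ϖ := by
  by_cases hS : z ∈ unitSquare
  · obtain ⟨m, hm⟩ := mem_iUnion.1 (interior_subset hz)
    rw [closure_cellTranslate, mem_cellTranslate] at hm
    by_cases h0 : m = 0
    · simpa [h0] using hm
    -- A translate with nonzero index has its closure in another closed unit square, which misses
    -- the open one.
    · exfalso
      refine add_notMem_closure_unitSquare hS (m := -m) (by simpa using h0) ?_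
      rw [latticePt_neg, ← sub_eq_add_neg]
      exact closure_mono h.subset_square hm
  · refine frontier_subset_closure (h.frontier_subset ?_)
    rw [frontier, isOpen_unitSquare.interior_eq]
    exact ⟨hz', hS⟩

/-- Integration over `Ω` is summation over the lattice translates of the cell. -/
lemma lintegral_periodicDomain {ϖ : Set ℂ} (h : IsPeriodicCell ϖ)
    (hnull : volume (periodicDomain ϖ \ ⋃ m : ℤ × ℤ, cellTranslate ϖ m) = 0) (u : ℂ → ℝ≥0∞) :
    ∫⁻ z in periodicDomain ϖ, u z = ∑' m : ℤ × ℤ, ∫⁻ z in ϖ, u (z + latticePt m) := by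
  have h1 : (periodicDomain ϖ : Set ℂ) =ᵐ[volume] ⋃ m : ℤ × ℤ, cellTranslate ϖ m := by
    refine Filter.EventuallyLE.antisymm (ae_le_set.2 hnull) ?_
    exact (iUnion_subset h.translate_subset).eventuallyLE
  have h2 : ∀ m : ℤ × ℤ, MeasurableSet (cellTranslate ϖ m) := fun m =>
    ((isOpenMap_add_right (latticePt m)) ϖ h.isOpen).measurableSet
  rw [Measure.restrict_congr_set h1, lintegral_iUnion h2 (pairwise_disjoint_cellTranslate h)]
  refine tsum_congr fun m => ?_
  exact (((measurePreserving_add_right volume (latticePt m)).restrict_image_emb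
    (measurableEmbedding_addRight (latticePt m)) ϖ).lintegral_comp_emb
    (measurableEmbedding_addRight (latticePt m)) u).symm

/-! ### Bergman spaces -/

open Filter Topology in
-- Norm convergence gives almost everywhere convergence along a subsequence, which identifies the
-- two limits.
lemma ae_eq_of_tendsto_of_ae_tendsto {α E : Type*} [MeasurableSpace α] {μ : Measure α}
    [NormedAddCommGroup E] {p : ℝ≥0∞} [Fact (1 ≤ p)] {u : ℕ → Lp E p μ} {S : Lp E p μ}
    (h : Tendsto u atTop (𝓝 S)) {s : α → E}
    (hs : ∀ᵐ x ∂μ, Tendsto (fun n => u n x) atTop (𝓝 (s x))) : S =ᵐ[μ] s := by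
  obtain ⟨ns, hns, hns'⟩ := (tendstoInMeasure_of_tendsto_Lp h).exists_seq_tendsto_ae
  filter_upwards [hs, hns'] with x h1 h2
  exact tendsto_nhds_unique h2 (h1.comp hns.tendsto_atTop)

/-- Mean value property on each circle, integrated over the radius in polar coordinates. -/
lemma setIntegral_ball_eq {G : ℂ → ℂ} {z : ℂ} {r : ℝ} (hr : 0 < r)
    (hG : DifferentiableOn ℂ G (Metric.closedBall z r)) :
    ∫ w in Metric.ball z r, G w = (Real.pi * r ^ 2 : ℂ) * G z := by
  have hcirc : ∀ ρ ∈ Ioo (0 : ℝ) r,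
      ∫ θ in Ioo (-Real.pi) Real.pi, ρ • G (circleMap z ρ θ) = (ρ : ℂ) * (2 * Real.pi * G z) := by
    intro ρ hρ
    have hd : DiffContOnCl ℂ G (Metric.ball z |ρ|) := by
      refine (hG.mono ?_).diffContOnCl
      rw [closure_ball _ (by simpa using hρ.1.ne'), abs_of_pos hρ.1]
      exact Metric.closedBall_subset_closedBall hρ.2.le
    have h1 := hd.circleAverage
    rw [Real.circleAverage_def] at h1
    have h2 : ∫ θ in (0 : ℝ)..(2 * Real.pi), G (circleMap z ρ θ) = 2 * Real.pi * G z := by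
      rw [← h1, real_smul]
      push_cast
      have := Real.pi_ne_zero
      field_simp
    have h3 : Function.Periodic (fun θ => G (circleMap z ρ θ)) (2 * Real.pi) := fun θ => by
      simp only [periodic_circleMap z ρ θ]
    -- Periodicity moves the angle from `[0, 2π]` to the range `(-π, π)` of polar coordinates.
    have h4 := h3.intervalIntegral_add_eq 0 (-Real.pi)
    rw [zero_add, h2, show -Real.pi + 2 * Real.pi = Real.pi by ring,
      intervalIntegral.integral_of_le (by linarith [Real.pi_pos]),
      integral_Ioc_eq_integral_Ioo] at h4
    rw [integral_smul, ← h4, real_smul]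
  have hpol : ∀ p ∈ polarCoord.target,
      p.1 • (Metric.ball z r).indicator G (z + Complex.polarCoord.symm p) =
        (Ioo 0 r ×ˢ Ioo (-Real.pi) Real.pi).indicator (fun p => p.1 • G (circleMap z p.1 p.2)) p := by
    rintro ⟨ρ, θ⟩ hp
    rw [polarCoord_target] at hp
    obtain ⟨h1, h2⟩ := hp
    have hc : z + Complex.polarCoord.symm (ρ, θ) = circleMap z ρ θ := by
      rw [Complex.polarCoord_symm_apply, circleMap, exp_mul_I]; push_cast; rfl
    have hm : circleMap z ρ θ ∈ Metric.ball z r ↔ ρ < r := by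
      rw [Metric.mem_ball, dist_eq_norm, circleMap_sub_center, norm_circleMap_zero,
        abs_of_pos h1]
    rw [hc]
    by_cases h : ρ < r
    · rw [indicator_of_mem (hm.2 h), indicator_of_mem (mk_mem_prod (mem_Ioo.2 ⟨h1, h⟩) h2)]
    · rw [indicator_of_notMem (fun k => h (hm.1 k)), smul_zero,
        indicator_of_notMem (fun k => h k.1.2)]
  have hint : IntegrableOn (fun p : ℝ × ℝ => p.1 • G (circleMap z p.1 p.2))
      (Ioo 0 r ×ˢ Ioo (-Real.pi) Real.pi) (volume.prod volume) := by
    have hK : IsCompact (Icc (0 : ℝ) r ×ˢ Icc (-Real.pi) Real.pi) := isCompact_Icc.prod isCompact_Icc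
    refine (ContinuousOn.integrableOn_compact hK ?_).mono_set
      (prod_mono Ioo_subset_Icc_self Ioo_subset_Icc_self)
    refine continuousOn_fst.smul (hG.continuousOn.comp ?_ ?_)
    · unfold circleMap; fun_prop
    · rintro ⟨ρ, θ⟩ ⟨h1, -⟩
      rw [Metric.mem_closedBall, dist_eq_norm, circleMap_sub_center, norm_circleMap_zero,
        abs_of_nonneg h1.1]
      exact h1.2
  rw [← integral_indicator measurableSet_ball, ← integral_add_left_eq_self _ z,
    ← Complex.integral_comp_polarCoord_symm,
    setIntegral_congr_fun (polarCoord.open_target.measurableSet) hpol,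
    setIntegral_indicator (measurableSet_Ioo.prod measurableSet_Ioo), polarCoord_target,
    inter_eq_self_of_subset_right (prod_mono (fun x hx => hx.1) subset_rfl), Measure.volume_eq_prod,
    setIntegral_prod _ hint, setIntegral_congr_fun measurableSet_Ioo hcirc,
    integral_mul_const, integral_complex_ofReal, ← integral_Ioc_eq_integral_Ioo,
    ← intervalIntegral.integral_of_le hr.le, integral_id]
  push_cast
  ring

/-- The average over a disc as a functional on `L²(D)`. -/
noncomputable def ballAvg (D : Set ℂ) (z : ℂ) (r : ℝ) : L2 D →L[ℂ] ℂ :=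
  ((Real.pi * r ^ 2 : ℂ)⁻¹) • innerSL ℂ (indicatorConstLp (μ := volume.restrict D) 2
    (measurableSet_ball (x := z) (ε := r))
    ((Measure.restrict_apply_le _ _).trans_lt measure_ball_lt_top).ne 1)

/-- On analytic functions point evaluation is thus a bounded functional defined on all of `L2 D`, so
it passes through limits and Bochner integrals and does not depend on the chosen representative. -/
lemma ballAvg_apply {D : Set ℂ} {z : ℂ} {r : ℝ} (hr : 0 < r) (hD : Metric.closedBall z r ⊆ D)
    {f : L2 D} {G : ℂ → ℂ} (hG : DifferentiableOn ℂ G D) (hf : f =ᵐ[volume.restrict D] G) :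
    ballAvg D z r f = G z := by
  have h1 : ∫ w in Metric.ball z r, f w ∂(volume.restrict D) = (Real.pi * r ^ 2 : ℂ) * G z := by
    rw [← setIntegral_ball_eq hr (hG.mono hD), Measure.restrict_restrict measurableSet_ball,
      inter_eq_self_of_subset_left (Metric.ball_subset_closedBall.trans hD)]
    exact integral_congr_ae (ae_restrict_of_ae_restrict_of_subset
      (Metric.ball_subset_closedBall.trans hD) hf)
  have h2 : (Real.pi * r ^ 2 : ℂ) ≠ 0 := by
    exact_mod_cast (mul_pos Real.pi_pos (pow_pos hr 2)).ne'
  rw [ballAvg, smul_apply, innerSL_apply_apply, L2.inner_indicatorConstLp_one,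
    h1, smul_eq_mul, inv_mul_cancel_left₀ h2]

/-- A bound for the norm of disc averages, uniform in the centre. -/
lemma exists_norm_ballAvg_le (D : Set ℂ) (r : ℝ) : ∃ C, ∀ z, ‖ballAvg D z r‖ ≤ C := by
  refine ⟨‖((Real.pi * r ^ 2 : ℂ)⁻¹)‖ * (volume.real (Metric.ball (0 : ℂ) r)) ^ (1 / 2 : ℝ),
    fun z => ?_⟩
  rw [ballAvg, norm_smul, innerSL_apply_norm,
    norm_indicatorConstLp (by norm_num) (by norm_num), norm_one, one_mul, ENNReal.toReal_ofNat]
  gcongr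
  have : volume.real (Metric.ball (0 : ℂ) r) = volume.real (Metric.ball z r) := by
    simp [Measure.real, Complex.volume_ball]
  rw [this]
  exact ENNReal.toReal_mono measure_ball_lt_top.ne (Measure.restrict_apply_le _ _)

lemma differentiableOn_analyticRep {D : Set ℂ} {f : L2 D} (hf : f ∈ bergmanSpace D) :
    DifferentiableOn ℂ (analyticRep D f) D := by
  rw [analyticRep, dif_pos hf]; exact (Exists.choose_spec hf).1

lemma ae_eq_analyticRep {D : Set ℂ} {f : L2 D} (hf : f ∈ bergmanSpace D) :
    f =ᵐ[volume.restrict D] analyticRep D f := by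
  rw [analyticRep, dif_pos hf]; exact (Exists.choose_spec hf).2

lemma ballAvg_eq_analyticRep {D : Set ℂ} {z : ℂ} {r : ℝ} (hr : 0 < r)
    (hD : Metric.closedBall z r ⊆ D) {f : L2 D} (hf : f ∈ bergmanSpace D) :
    ballAvg D z r f = analyticRep D f z :=
  ballAvg_apply hr hD (differentiableOn_analyticRep hf) (ae_eq_analyticRep hf)

open Filter Topology in
-- Disc averages of a fixed radius are bounded uniformly in the centre, so `L²` convergence of
-- analytic functions forces locally uniform convergence of their representatives.
lemma isClosed_bergmanSpace {D : Set ℂ} (hD : IsOpen D) :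
    IsClosed (bergmanSpace D : Set (L2 D)) := by
  refine IsSeqClosed.isClosed fun f F hf hlim => ?_
  set G : ℕ → ℂ → ℂ := fun n => analyticRep D (f n)
  have hball : ∀ z ∈ D, ∃ r > 0, Metric.closedBall z r ⊆ D := fun z hz =>
    Metric.nhds_basis_closedBall.mem_iff.1 (hD.mem_nhds hz)
  have hpt : ∀ z r, 0 < r → Metric.closedBall z r ⊆ D →
      Tendsto (fun n => G n z) atTop (𝓝 (ballAvg D z r F)) := fun z r hr hz =>
    (((ballAvg D z r).continuous.tendsto F).comp hlim).congr fun n =>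
      ballAvg_eq_analyticRep hr hz (hf n)
  choose! r hr0 hr using hball
  set g : ℂ → ℂ := fun z => ballAvg D z (r z) F
  have hunif : TendstoLocallyUniformlyOn G g atTop D := by
    rw [Metric.tendstoLocallyUniformlyOn_iff]
    intro ε hε z hz
    obtain ⟨C, hC⟩ := exists_norm_ballAvg_le D (r z / 2)
    have hC0 : 0 ≤ C := (norm_nonneg _).trans (hC 0)
    refine ⟨Metric.ball z (r z / 2),
      mem_nhdsWithin_of_mem_nhds (Metric.ball_mem_nhds z (half_pos (hr0 z hz))), ?_⟩
    have h1 : ∀ᶠ n in atTop, dist (f n) F < ε / (C + 1) :=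
      hlim.eventually (Metric.ball_mem_nhds F (by positivity))
    filter_upwards [h1] with n hn w hw
    have hw1 : Metric.closedBall w (r z / 2) ⊆ D := by
      refine (Metric.closedBall_subset_closedBall' ?_).trans (hr z hz)
      linarith [Metric.mem_ball.1 hw]
    have hwD : w ∈ D := hw1 (Metric.mem_closedBall_self (half_pos (hr0 z hz)).le)
    -- The radius `r w` may vary wildly with `w`; both averages are limits of the same sequence, so
    -- a radius common to all `w` near `z` may be used.
    have h2 : g w = ballAvg D w (r z / 2) F :=
      tendsto_nhds_unique (hpt w _ (hr0 w hwD) (hr w hwD)) (hpt w _ (half_pos (hr0 z hz)) hw1)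
    rw [h2, show G n w = _ from (ballAvg_eq_analyticRep (half_pos (hr0 z hz)) hw1 (hf n)).symm,
      dist_eq_norm, ← map_sub]
    calc ‖ballAvg D w (r z / 2) (F - f n)‖ ≤ C * ‖F - f n‖ :=
          (ballAvg D w (r z / 2)).le_of_opNorm_le (hC w) _
      _ ≤ (C + 1) * ‖F - f n‖ := by gcongr; linarith
      _ < (C + 1) * (ε / (C + 1)) := by
          rw [← dist_eq_norm, dist_comm]; gcongr
      _ = ε := by field_simp
  refine ⟨g, hunif.differentiableOn (.of_forall fun n => differentiableOn_analyticRep (hf n)) hD,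
    ae_eq_of_tendsto_of_ae_tendsto hlim ?_⟩
  filter_upwards [ae_all_iff.2 fun n => ae_eq_analyticRep (hf n),
    ae_restrict_mem hD.measurableSet] with z h1 h2
  simp only [h1]
  exact hpt z _ (hr0 z h2) (hr z h2)

/-! ### Fourier series on the square of Floquet parameters -/

instance : IsFiniteMeasure (volume.restrict floquetBox : Measure (ℝ × ℝ)) :=
  ⟨by
    rw [Measure.restrict_apply_univ]
    exact (isCompact_Icc.prod isCompact_Icc).measure_lt_top⟩

lemma isCompact_floquetBox : IsCompact floquetBox := isCompact_Icc.prod isCompact_Icc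

lemma continuous_phase (m : ℤ × ℤ) : Continuous fun η => phase η m := by unfold phase; fun_prop

lemma phase_add (η : ℝ × ℝ) (m n : ℤ × ℤ) : phase η (m + n) = phase η m + phase η n := by
  simp only [phase, Prod.fst_add, Prod.snd_add]; push_cast; ring

lemma phase_neg (η : ℝ × ℝ) (m : ℤ × ℤ) : phase η (-m) = -phase η m := by
  simp only [phase, Prod.fst_neg, Prod.snd_neg]; push_cast; ring

lemma phase_sub (η : ℝ × ℝ) (m n : ℤ × ℤ) : phase η (m - n) = phase η m - phase η n := by
  rw [sub_eq_add_neg, phase_add, phase_neg, sub_eq_add_neg]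

@[simp] lemma phase_zero (η : ℝ × ℝ) : phase η 0 = 0 := by simp [phase]

lemma integral_exp_int (n : ℤ) :
    ∫ x in Icc (-Real.pi) Real.pi, exp ((x * n : ℝ) * I) = if n = 0 then (2 * Real.pi : ℂ) else 0 := by
  rw [integral_Icc_eq_integral_Ioc, ← intervalIntegral.integral_of_le (by linarith [Real.pi_pos])]
  split_ifs with h
  · subst h; simp; ring
  · have h1 : ((n : ℂ) * I) ≠ 0 := mul_ne_zero (by exact_mod_cast h) I_ne_zero
    have h2 : ∀ x : ℝ, exp ((x * n : ℝ) * I) = exp (n * I * x) := fun x => by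
      push_cast; congr 1; ring
    simp_rw [h2]
    rw [integral_exp_mul_complex h1, div_eq_zero_iff]
    left
    have h3 : (n * I * (Real.pi : ℝ) : ℂ) = n * I * (-Real.pi : ℝ) + n * (2 * Real.pi * I) := by
      push_cast; ring
    rw [h3, exp_add, exp_int_mul_two_pi_mul_I, mul_one, sub_self]

lemma integral_exp_phase (m : ℤ × ℤ) :
    ∫ η in floquetBox, exp ((phase η m : ℂ) * I) =
      if m = 0 then (2 * Real.pi : ℂ) ^ 2 else 0 := by
  have h1 : ∀ η : ℝ × ℝ, exp ((phase η m : ℂ) * I) =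
      exp ((η.1 * m.1 : ℝ) * I) * exp ((η.2 * m.2 : ℝ) * I) := fun η => by
    rw [← exp_add, phase]; push_cast; congr 1; ring
  simp_rw [h1]
  rw [floquetBox, Measure.volume_eq_prod,
    setIntegral_prod_mul (fun x : ℝ => exp ((x * m.1 : ℝ) * I))
      (fun x : ℝ => exp ((x * m.2 : ℝ) * I)), integral_exp_int, integral_exp_int]
  by_cases h : m = 0
  · simp [h]; ring
  · rw [if_neg h]
    have : m.1 ≠ 0 ∨ m.2 ≠ 0 := by
      by_contra! h'
      exact h (Prod.ext h'.1 h'.2)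
    rcases this with h | h <;> simp [h]

lemma conj_exp_neg_mul_I (x : ℝ) : (starRingEnd ℂ) (exp (-(x : ℂ) * I)) = exp ((x : ℂ) * I) := by
  rw [← exp_conj]; simp

lemma coeFn_term {D : Set ℂ} (m : ℤ × ℤ) (v : L2 D) :
    ((memLp_term m v).toLp _ : BochnerL2 D) =ᵐ[volume.restrict floquetBox]
      fun η : ℝ × ℝ => ((1 / (2 * Real.pi) : ℂ) * exp (-(phase η m : ℂ) * I)) • v :=
  (memLp_term m v).coeFn_toLp

lemma inner_term_left {D : Set ℂ} (m : ℤ × ℤ) (v : L2 D) (g : BochnerL2 D) :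
    inner ℂ ((memLp_term m v).toLp _ : BochnerL2 D) g =
      (1 / (2 * Real.pi) : ℂ) *
        ∫ η in floquetBox, exp ((phase η m : ℂ) * I) * inner ℂ v (g η) := by
  rw [L2.inner_def, ← integral_const_mul]
  refine integral_congr_ae ?_
  filter_upwards [coeFn_term m v] with η h
  rw [h, inner_smul_left, map_mul, conj_exp_neg_mul_I]
  have : (starRingEnd ℂ) (1 / (2 * Real.pi) : ℂ) = 1 / (2 * Real.pi) := by
    simp [Complex.conj_ofNat]
  rw [this, mul_assoc]

lemma inner_term_term {D : Set ℂ} (m k : ℤ × ℤ) (v w : L2 D) :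
    inner ℂ ((memLp_term m v).toLp _ : BochnerL2 D) ((memLp_term k w).toLp _ : BochnerL2 D) =
      if m = k then inner ℂ v w else 0 := by
  have h1 : ∫ η in floquetBox, exp ((phase η m : ℂ) * I) *
      inner ℂ v (((memLp_term k w).toLp _ : BochnerL2 D) η) =
      ∫ η in floquetBox, exp ((phase η (m - k) : ℂ) * I) * (1 / (2 * Real.pi) * inner ℂ v w) := by
    refine integral_congr_ae ?_
    filter_upwards [coeFn_term k w] with η h
    rw [h, inner_smul_right, phase_sub]
    push_cast
    rw [sub_mul, sub_eq_add_neg, exp_add, neg_mul]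
    ring
  rw [inner_term_left, h1, integral_mul_const, integral_exp_phase]
  simp only [sub_eq_zero]
  have := Real.pi_ne_zero
  split_ifs
  · have : (Real.pi : ℂ) ≠ 0 := by exact_mod_cast this
    field_simp
  · simp

/-- The isometry `v ↦ (2π)⁻¹ e^{-i η₁ m₁ - i η₂ m₂} v` into the Bochner space. -/
noncomputable def termL (D : Set ℂ) (m : ℤ × ℤ) : L2 D →ₗᵢ[ℂ] BochnerL2 D :=
  LinearMap.isometryOfInner
    { toFun := fun v => (memLp_term m v).toLp _
      map_add' := fun v w => by
        rw [← MemLp.toLp_add]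
        exact MemLp.toLp_congr _ _ (.of_forall fun η => smul_add _ _ _)
      map_smul' := fun c v => by
        rw [RingHom.id_apply, ← MemLp.toLp_const_smul]
        exact MemLp.toLp_congr _ _ (.of_forall fun η => smul_comm _ _ _) }
    (fun v w => by simpa using inner_term_term m m v w)

lemma coeFn_termL {D : Set ℂ} (m : ℤ × ℤ) (v : L2 D) :
    termL D m v =ᵐ[volume.restrict floquetBox]
      fun η : ℝ × ℝ => ((1 / (2 * Real.pi) : ℂ) * exp (-(phase η m : ℂ) * I)) • v :=
  coeFn_term m v

lemma inner_termL_left {D : Set ℂ} (m : ℤ × ℤ) (v : L2 D) (g : BochnerL2 D) :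
    inner ℂ (termL D m v) g = (1 / (2 * Real.pi) : ℂ) *
        ∫ η in floquetBox, exp ((phase η m : ℂ) * I) * inner ℂ v (g η) :=
  inner_term_left m v g

lemma orthogonalFamily_termL (D : Set ℂ) :
    OrthogonalFamily ℂ (fun _ : ℤ × ℤ => L2 D) (termL D) := fun m k hmk v w =>
  (inner_term_term m k v w).trans (if_neg hmk)

/-- Fibrewise application of a bounded operator preserves the mode, so Floquet series can be moved
between domains term by term. -/
lemma compLpL_termL {D D' : Set ℂ} (L : L2 D →L[ℂ] L2 D') (m : ℤ × ℤ) (v : L2 D) :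
    L.compLpL 2 (volume.restrict floquetBox) (termL D m v) = termL D' m (L v) := by
  refine Lp.ext ?_
  filter_upwards [L.coeFn_compLpL (termL D m v), coeFn_termL m v, coeFn_termL m (L v)]
    with η h1 h2 h3
  rw [h1, h2, h3, map_smul]

lemma norm_exp_ofReal_mul_I_mul (x : ℝ) (c : ℂ) : ‖exp ((x : ℂ) * I) * c‖ = ‖c‖ := by
  rw [norm_mul, norm_exp_ofReal_mul_I, one_mul]

lemma memLp_mulPhase {D : Set ℂ} (k : ℤ × ℤ) (g : BochnerL2 D) :
    MemLp (fun η : ℝ × ℝ => exp ((phase η k : ℂ) * I) • g η) 2 (volume.restrict floquetBox) := by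
  refine (Lp.memLp g).of_le ?_ (.of_forall fun η => ?_)
  · refine AEStronglyMeasurable.smul (f := fun η => exp ((phase η k : ℂ) * I))
      (Continuous.aestronglyMeasurable ?_) (Lp.memLp g).1
    have := continuous_phase k
    fun_prop
  · rw [norm_smul, norm_exp_ofReal_mul_I, one_mul]

/-- Multiplication by `e^{i η₁ k₁ + i η₂ k₂}` on the Bochner space. -/
noncomputable def mulPhase (D : Set ℂ) (k : ℤ × ℤ) : BochnerL2 D →L[ℂ] BochnerL2 D :=
  LinearMap.mkContinuous
    { toFun := fun g => (memLp_mulPhase k g).toLp _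
      map_add' := fun f g => by
        rw [← MemLp.toLp_add]
        refine MemLp.toLp_congr _ _ ?_
        filter_upwards [Lp.coeFn_add f g] with η h
        rw [h, Pi.add_apply, smul_add]; rfl
      map_smul' := fun c f => by
        rw [RingHom.id_apply, ← MemLp.toLp_const_smul]
        refine MemLp.toLp_congr _ _ ?_
        filter_upwards [Lp.coeFn_smul c f] with η h
        rw [h, Pi.smul_apply, smul_comm]; rfl }
    1 (fun g => by
      rw [one_mul]
      refine Lp.norm_le_norm_of_ae_le ?_
      filter_upwards [(memLp_mulPhase k g).coeFn_toLp] with η h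
      rw [LinearMap.coe_mk, AddHom.coe_mk, h, norm_smul, norm_exp_ofReal_mul_I, one_mul])

lemma coeFn_mulPhase {D : Set ℂ} (k : ℤ × ℤ) (g : BochnerL2 D) :
    mulPhase D k g =ᵐ[volume.restrict floquetBox]
      fun η : ℝ × ℝ => exp ((phase η k : ℂ) * I) • g η :=
  (memLp_mulPhase k g).coeFn_toLp

lemma mulPhase_termL {D : Set ℂ} (k m : ℤ × ℤ) (v : L2 D) :
    mulPhase D k (termL D m v) = termL D (m - k) v := by
  refine Lp.ext ?_
  filter_upwards [coeFn_mulPhase k (termL D m v), coeFn_termL m v, coeFn_termL (m - k) v]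
    with η h1 h2 h3
  rw [h1, h2, h3, smul_smul, phase_sub]
  push_cast
  rw [neg_sub, sub_mul, sub_eq_add_neg, exp_add, neg_mul]
  ring_nf

/-- The covering map from the parameter plane to the torus. -/
noncomputable def toTorus (η : ℝ × ℝ) : UnitAddTorus (Fin 2) :=
  ![((η.1 / (2 * Real.pi) : ℝ) : UnitAddCircle), ((η.2 / (2 * Real.pi) : ℝ) : UnitAddCircle)]

lemma continuous_toTorus : Continuous toTorus := by
  refine continuous_pi fun i => ?_
  fin_cases i
  · exact (AddCircle.continuous_mk' 1).comp (by fun_prop)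
  · exact (AddCircle.continuous_mk' 1).comp (by fun_prop)

lemma mFourier_toTorus (n : Fin 2 → ℤ) (η : ℝ × ℝ) :
    UnitAddTorus.mFourier n (toTorus η) = exp ((phase η (n 0, n 1) : ℂ) * I) := by
  have hpi : (Real.pi : ℂ) ≠ 0 := by exact_mod_cast Real.pi_ne_zero
  simp only [UnitAddTorus.mFourier, ContinuousMap.coe_mk, Fin.prod_univ_two, toTorus,
    Matrix.cons_val_zero, Matrix.cons_val_one, fourier_coe_apply, ← exp_add, phase]
  congr 1
  push_cast
  field_simp

/-- A measurable section of the covering map over the square of parameters. -/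
noncomputable def ofTorus (x : UnitAddTorus (Fin 2)) : ℝ × ℝ :=
  (2 * Real.pi * (AddCircle.measurableEquivIoc 1 (-1 / 2) (x 0) : ℝ),
    2 * Real.pi * (AddCircle.measurableEquivIoc 1 (-1 / 2) (x 1) : ℝ))

lemma measurable_ofTorus : Measurable ofTorus := by
  have h : ∀ i : Fin 2, Measurable fun x : UnitAddTorus (Fin 2) =>
      (AddCircle.measurableEquivIoc 1 (-1 / 2) (x i) : ℝ) := fun i =>
    measurable_subtype_coe.comp
      ((AddCircle.measurableEquivIoc (1 : ℝ) (-1 / 2)).measurable.comp (measurable_pi_apply i))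
  exact ((h 0).const_mul _).prodMk ((h 1).const_mul _)

/-- The half-open square is a fundamental domain; it differs from the closed square by a null set.
-/
lemma ofTorus_toTorus {η : ℝ × ℝ}
    (hη : η ∈ Ioc (-Real.pi) Real.pi ×ˢ Ioc (-Real.pi) Real.pi) : ofTorus (toTorus η) = η := by
  have hpi := Real.pi_pos
  have h : ∀ x ∈ Ioc (-Real.pi) Real.pi, 2 * Real.pi *
      (AddCircle.measurableEquivIoc (1 : ℝ) (-1 / 2)
        ((x / (2 * Real.pi) : ℝ) : UnitAddCircle) : ℝ) = x := by
    intro x hx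
    have hx' : x / (2 * Real.pi) ∈ Ioc (-1 / 2 : ℝ) (-1 / 2 + 1) := by
      constructor
      · rw [lt_div_iff₀ (by positivity)]; linarith [hx.1]
      · rw [div_le_iff₀ (by positivity)]; linarith [hx.2]
    have := AddCircle.equivIoc_coe_of_mem (p := (1 : ℝ)) hx'
    change 2 * Real.pi * (AddCircle.equivIoc (1 : ℝ) (-1 / 2) _ : ℝ) = x
    rw [this]
    field_simp
  exact Prod.ext (h _ hη.1) (h _ hη.2)

lemma floquetBox_ae_eq :
    (floquetBox : Set (ℝ × ℝ)) =ᵐ[volume] Ioc (-Real.pi) Real.pi ×ˢ Ioc (-Real.pi) Real.pi := by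
  rw [floquetBox, Measure.volume_eq_prod]
  exact Measure.set_prod_ae_eq Ioc_ae_eq_Icc.symm Ioc_ae_eq_Icc.symm

/-- Uniqueness of Fourier coefficients for square integrable functions of the parameters. -/
lemma ae_eq_zero_of_forall_integral_exp_phase {s : ℝ × ℝ → ℂ}
    (hs : MemLp s 2 (volume.restrict floquetBox))
    (h : ∀ k, ∫ η in floquetBox, exp ((phase η k : ℂ) * I) * s η = 0) :
    s =ᵐ[volume.restrict floquetBox] 0 := by
  have hsec : ∀ᵐ η ∂(volume.restrict floquetBox), ofTorus (toTorus η) = η := by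
    rw [Measure.restrict_congr_set floquetBox_ae_eq]
    filter_upwards [ae_restrict_mem (measurableSet_Ioc.prod measurableSet_Ioc)] with η hη
    exact ofTorus_toTorus hη
  have hq := continuous_toTorus.measurable
  -- The push-forward need not be identified with Haar measure: density of trigonometric polynomials
  -- in the continuous functions, and of these in `L²(ν)`, needs only that `ν` is finite.
  set ν : Measure (UnitAddTorus (Fin 2)) := (volume.restrict floquetBox).map toTorus with hν
  have : IsFiniteMeasure ν := Measure.isFiniteMeasure_map _ _
  -- A strongly measurable representative is needed so that its composition with the section is
  -- measurable on the torus.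
  obtain ⟨t, ht, hst⟩ := hs.1
  have hst' : ∀ᵐ η ∂(volume.restrict floquetBox), t (ofTorus (toTorus η)) = s η := by
    filter_upwards [hsec, hst] with η h1 h2
    rw [h1, h2]
  have hum : AEStronglyMeasurable (t ∘ ofTorus) ν :=
    (ht.comp_measurable measurable_ofTorus).aestronglyMeasurable
  have huL : MemLp (t ∘ ofTorus) 2 ν := by
    rw [hν, memLp_map_measure_iff hum hq.aemeasurable]
    exact hs.ae_eq (hst'.mono fun η h => h.symm)
  have hzero : ∀ n : Fin 2 → ℤ, inner ℂ (huL.toLp _)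
      (ContinuousMap.toLp (E := ℂ) 2 ν ℂ (UnitAddTorus.mFourier n)) = 0 := by
    intro n
    rw [inner_eq_zero_symm, L2.inner_def]
    have h1 : ∫ x, inner ℂ (ContinuousMap.toLp (E := ℂ) 2 ν ℂ (UnitAddTorus.mFourier n) x)
        (huL.toLp _ x) ∂ν = ∫ x, UnitAddTorus.mFourier (-n) x * (t ∘ ofTorus) x ∂ν := by
      refine integral_congr_ae ?_
      filter_upwards [huL.coeFn_toLp, ContinuousMap.coeFn_toLp (p := 2) (𝕜 := ℂ) ν
        (UnitAddTorus.mFourier n)] with x h1 h2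
      rw [h1, h2, UnitAddTorus.mFourier_neg, RCLike.inner_apply, mul_comm]
    rw [h1, hν, integral_map hq.aemeasurable
      (((UnitAddTorus.mFourier (-n)).continuous.aestronglyMeasurable).fun_mul hum), ← h ((-n) 0, (-n) 1)]
    refine integral_congr_ae ?_
    filter_upwards [hst'] with η h2
    rw [mFourier_toTorus, Function.comp_apply, h2]
  have hall : (innerSL ℂ (huL.toLp (t ∘ ofTorus))).comp
      (ContinuousMap.toLp (E := ℂ) 2 ν ℂ) = 0 := by
    refine ContinuousLinearMap.ext_on
      (Submodule.dense_iff_topologicalClosure_eq_top.2 UnitAddTorus.span_mFourier_closure_eq_top) ?_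
    rintro _ ⟨n, rfl⟩
    exact hzero n
  have hu0 : innerSL ℂ (huL.toLp (t ∘ ofTorus)) = 0 := by
    refine ContinuousLinearMap.coeFn_injective ?_
    refine (ContinuousMap.toLp_denseRange ℂ ν ℂ (by norm_num)).equalizer
      (ContinuousLinearMap.continuous _) (ContinuousLinearMap.continuous _) ?_
    ext ψ
    exact DFunLike.congr_fun hall ψ
  have hu1 : huL.toLp (t ∘ ofTorus) = 0 := by
    rw [← inner_self_eq_zero (𝕜 := ℂ)]
    exact DFunLike.congr_fun hu0 _
  have hu2 : t ∘ ofTorus =ᵐ[ν] 0 :=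
    huL.coeFn_toLp.symm.trans (hu1 ▸ Lp.coeFn_zero ℂ 2 ν)
  filter_upwards [hst', ae_of_ae_map hq.aemeasurable hu2] with η h1 h2
  rw [← h1]
  exact h2

/-! ### The Floquet series -/

lemma enorm_sq_eq_lintegral {D : Set ℂ} (f : L2 D) : ‖f‖ₑ ^ 2 = ∫⁻ z in D, ‖f z‖ₑ ^ 2 := by
  have h := eLpNorm_nnreal_pow_eq_lintegral (f := f) (μ := volume.restrict D) (p := 2) two_ne_zero
  rw [Lp.enorm_def]
  simpa using h

lemma enorm_sq_translateL {D D' : Set ℂ} {k : ℂ} (h : ∀ z ∈ D', z + k ∈ D) (f : L2 D) :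
    ‖translateL k h f‖ₑ ^ 2 = ∫⁻ z in D', ‖f (z + k)‖ₑ ^ 2 := by
  rw [enorm_sq_eq_lintegral]
  refine lintegral_congr_ae ?_
  filter_upwards [coeFn_translateL h f] with z hz
  rw [hz]

lemma enorm_sq_toReal {E : Type*} [SeminormedAddGroup E] (x : E) :
    (‖x‖ₑ ^ 2).toReal = ‖x‖ ^ 2 := by
  rw [ENNReal.toReal_pow, toReal_enorm]

/-- The integral of `|f|²` over `Ω` splits into integrals over the disjoint translates of the cell.
-/
lemma hasSum_norm_sq_shift {ϖ : Set ℂ} (h : IsPeriodicCell ϖ)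
    (hnull : volume (periodicDomain ϖ \ ⋃ m : ℤ × ℤ, cellTranslate ϖ m) = 0)
    (f : L2 (periodicDomain ϖ)) : HasSum (fun m => ‖shift h m f‖ ^ 2) (‖f‖ ^ 2) := by
  have h1 : ∑' m, ‖shift h m f‖ₑ ^ 2 = ‖f‖ₑ ^ 2 := by
    rw [enorm_sq_eq_lintegral, lintegral_periodicDomain h hnull]
    exact tsum_congr fun m => by rw [shift_eq_translateL, enorm_sq_translateL]
  have h2 : ∑' m, ‖shift h m f‖ₑ ^ 2 ≠ ⊤ := by
    rw [h1]; exact ENNReal.pow_ne_top enorm_ne_top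
  have h3 := ENNReal.hasSum_toReal h2
  rw [← ENNReal.tsum_toReal_eq (ENNReal.ne_top_of_tsum_ne_top h2), h1] at h3
  simpa only [enorm_sq_toReal] using h3

/-- A square neighbourhood of the closed unit square. -/
def bigSquare : Set ℂ := Ioo (-1 : ℝ) 2 ×ℂ Ioo (-1 : ℝ) 2

lemma isOpen_bigSquare : IsOpen bigSquare := isOpen_Ioo.reProdIm isOpen_Ioo

lemma mem_bigSquare {z : ℂ} :
    z ∈ bigSquare ↔ z.re ∈ Ioo (-1 : ℝ) 2 ∧ z.im ∈ Ioo (-1 : ℝ) 2 := mem_reProdIm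

lemma closure_unitSquare_subset_bigSquare : closure unitSquare ⊆ bigSquare := by
  intro z hz
  rw [mem_closure_unitSquare] at hz
  obtain ⟨⟨h1, h2⟩, h3, h4⟩ := hz
  exact mem_bigSquare.2 ⟨⟨by linarith, by linarith⟩, by linarith, by linarith⟩

lemma add_mem_bigSquare {z : ℂ} (hz : z ∈ unitSquare) {m : ℤ × ℤ}
    (hm : z + latticePt m ∈ bigSquare) : m ∈ Finset.Icc (-1 : ℤ) 1 ×ˢ Finset.Icc (-1 : ℤ) 1 := by
  rw [mem_bigSquare] at hm
  simp only [add_re, add_im, latticePt_re, latticePt_im, mem_Ioo] at hm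
  obtain ⟨⟨h1, h2⟩, h3, h4⟩ := hz
  obtain ⟨⟨k1, k2⟩, k3, k4⟩ := hm
  have a1 : (-2 : ℝ) < m.1 := by linarith
  have a2 : (m.1 : ℝ) < 2 := by linarith
  have a3 : (-2 : ℝ) < m.2 := by linarith
  have a4 : (m.2 : ℝ) < 2 := by linarith
  norm_cast at a1 a2 a3 a4
  simp only [Finset.mem_product, Finset.mem_Icc]
  omega

/-- The part of `Ω` near the closed unit square. -/
def cellNhd (ϖ : Set ℂ) : Set ℂ := periodicDomain ϖ ∩ bigSquare

lemma isOpen_cellNhd (ϖ : Set ℂ) : IsOpen (cellNhd ϖ) :=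
  (isOpen_periodicDomain ϖ).inter isOpen_bigSquare

/-- The element `z ↦ f(z + m)` of `L²` of the neighbourhood of the cell. -/
noncomputable def nhdShift (ϖ : Set ℂ) (m : ℤ × ℤ) :
    L2 (periodicDomain ϖ) →L[ℂ] L2 (cellNhd ϖ) :=
  translateL (latticePt m) fun _ hz => add_mem_periodicDomain m hz.1

/-- The neighbourhood meets at most nine translates of the cell up to a null set, so the sum is at
most nine times the squared norm of `f`. -/
lemma summable_norm_sq_nhdShift {ϖ : Set ℂ} (h : IsPeriodicCell ϖ)
    (hnull : volume (periodicDomain ϖ \ ⋃ m : ℤ × ℤ, cellTranslate ϖ m) = 0)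
    (f : L2 (periodicDomain ϖ)) : Summable fun m => ‖nhdShift ϖ m f‖ ^ 2 := by
  set B : Finset (ℤ × ℤ) := Finset.Icc (-1 : ℤ) 1 ×ˢ Finset.Icc (-1 : ℤ) 1
  have h1 : ∀ m, ‖nhdShift ϖ m f‖ₑ ^ 2 ≤
      ∑ n ∈ B, ∫⁻ z in ϖ, ‖f (z + latticePt (n + m))‖ₑ ^ 2 := by
    intro m
    have h2 : ‖nhdShift ϖ m f‖ₑ ^ 2 = ∑' n, ∫⁻ z in ϖ,
        bigSquare.indicator (fun z => ‖f (z + latticePt m)‖ₑ ^ 2) (z + latticePt n) := by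
      rw [nhdShift, enorm_sq_translateL, ← lintegral_periodicDomain h hnull,
        setLIntegral_indicator isOpen_bigSquare.measurableSet, inter_comm, cellNhd]
    rw [h2, tsum_eq_sum (s := B)]
    · refine Finset.sum_le_sum fun n _ => lintegral_mono fun z => ?_
      refine (indicator_le_self _ _ _).trans (le_of_eq ?_)
      rw [latticePt_add, add_assoc]
    · intro n hn
      rw [setLIntegral_congr_fun (g := 0) h.isOpen.measurableSet, Pi.zero_def, lintegral_zero]
      intro z hz
      exact indicator_of_notMem (fun k => hn (add_mem_bigSquare (h.subset_square hz) k)) _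
  have h3 : ∑' m, ‖nhdShift ϖ m f‖ₑ ^ 2 ≠ ⊤ := by
    refine ne_top_of_le_ne_top ?_ (ENNReal.tsum_le_tsum h1)
    rw [Summable.tsum_finsetSum fun _ _ => ENNReal.summable]
    refine (ENNReal.sum_lt_top.2 fun n _ => ?_).ne
    have h4 := (Equiv.addLeft n).tsum_eq fun m => ∫⁻ z in ϖ, ‖f (z + latticePt m)‖ₑ ^ 2
    rw [Equiv.coe_addLeft] at h4
    rw [h4, ← lintegral_periodicDomain h hnull (fun z => ‖f z‖ₑ ^ 2), ← enorm_sq_eq_lintegral]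
    exact ENNReal.pow_lt_top enorm_lt_top
  simpa only [enorm_sq_toReal] using ENNReal.summable_toReal h3

lemma hasSum_compLpL_termL {D D' : Set ℂ} (L : L2 D →L[ℂ] L2 D') {u : ℤ × ℤ → L2 D}
    {S : BochnerL2 D} (hS : HasSum (fun m => termL D m (u m)) S) :
    HasSum (fun m => termL D' m (L (u m))) (L.compLpL 2 (volume.restrict floquetBox) S) := by
  simpa only [compLpL_termL] using (L.compLpL 2 (volume.restrict floquetBox)).hasSum hS

/-- The orthogonal projection onto `Kᗮ`, applied fibrewise, kills every term and hence the sum. -/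
lemma ae_mem_of_hasSum_termL {D : Set ℂ} {K : Submodule ℂ (L2 D)} (hK : IsClosed (K : Set (L2 D)))
    {u : ℤ × ℤ → L2 D} (hu : ∀ m, u m ∈ K) {S : BochnerL2 D}
    (hS : HasSum (fun m => termL D m (u m)) S) :
    ∀ᵐ η ∂(volume.restrict floquetBox), S η ∈ K := by
  have : CompleteSpace K := hK.completeSpace_coe
  have h1 := hasSum_compLpL_termL Kᗮ.starProjection hS
  have h2 : ∀ m, Kᗮ.starProjection (u m) = 0 := fun m =>
    (Submodule.starProjection_apply_eq_zero_iff _).2 (by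
      rw [Submodule.orthogonal_orthogonal]; exact hu m)
  simp only [h2, map_zero] at h1
  have h3 := h1.unique hasSum_zero
  filter_upwards [Kᗮ.starProjection.coeFn_compLpL (p := 2) (μ := volume.restrict floquetBox) S,
    Lp.coeFn_zero (L2 D) 2 (volume.restrict floquetBox)] with η h4 h5
  rw [h3, h5, Pi.zero_apply] at h4
  have h6 := (Submodule.starProjection_apply_eq_zero_iff Kᗮ).1 h4.symm
  rwa [Submodule.orthogonal_orthogonal] at h6

/-- Shifting the summation index by `e` in the series for `A` costs exactly the character of `e`.
With `A` a restriction and `B` a translation, this is quasiperiodicity of the fibres. -/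
lemma ae_eq_of_hasSum_termL {D D' : Set ℂ} (A B : L2 D →L[ℂ] L2 D') (e : ℤ × ℤ)
    {u : ℤ × ℤ → L2 D} (hu : ∀ m, B (u m) = A (u (m + e))) {S : BochnerL2 D}
    (hS : HasSum (fun m => termL D m (u m)) S) :
    ∀ᵐ η ∂(volume.restrict floquetBox), B (S η) = exp ((phase η e : ℂ) * I) • A (S η) := by
  have h1 := hasSum_compLpL_termL B hS
  have h2 := (mulPhase D' e).hasSum (hasSum_compLpL_termL A hS)
  rw [← (Equiv.addRight e).hasSum_iff] at h2
  simp only [Function.comp_def, mulPhase_termL, Equiv.coe_addRight, add_sub_cancel_right,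
    ← hu] at h2
  have h3 := h1.unique h2
  filter_upwards [B.coeFn_compLpL (p := 2) (μ := volume.restrict floquetBox) S,
    A.coeFn_compLpL (p := 2) (μ := volume.restrict floquetBox) S,
    coeFn_mulPhase e (A.compLpL 2 (volume.restrict floquetBox) S)] with η h4 h5 h6
  rw [← h4, h3, h6, h5]

lemma bergmanExt_le_bergmanEta (ϖ : Set ℂ) (η : ℝ × ℝ) : bergmanExt ϖ η ≤ bergmanEta ϖ η :=
  fun _ hf => ⟨Submodule.le_topologicalClosure _ hf, hf.1⟩

/-- A relation `v(· + e) = c v` almost everywhere holds everywhere for analytic representatives. -/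
lemma analyticRep_add_eq {W : Set ℂ} (hW : IsOpen W) {v : L2 W} (hv : v ∈ bergmanSpace W) {k c : ℂ}
    (hk : translateL (D' := {z | z ∈ W ∧ z + k ∈ W}) k (fun _ hz => hz.2) v =
      c • translateL (D' := {z | z ∈ W ∧ z + k ∈ W}) 0 (fun z hz => by simpa using hz.1) v)
    {z : ℂ} (hz : z ∈ W) (hz' : z + k ∈ W) :
    analyticRep W v (z + k) = c * analyticRep W v z := by
  set W' : Set ℂ := {z | z ∈ W ∧ z + k ∈ W}
  have hW' : IsOpen W' := hW.inter (hW.preimage (continuous_add_const k))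
  have hG := (differentiableOn_analyticRep hv).continuousOn
  have h1 : (fun z => analyticRep W v (z + k)) =ᵐ[volume.restrict W']
      fun z => c * analyticRep W v z := by
    refine (translateL_congr (D' := W') (fun _ hz => hz.2) (ae_eq_analyticRep hv)).symm.trans ?_
    rw [hk]
    refine (Lp.coeFn_smul _ _).trans ?_
    filter_upwards [translateL_congr (D' := W') (k := 0) (fun z hz => by simpa using hz.1)
      (ae_eq_analyticRep hv)] with z h2
    rw [Pi.smul_apply, h2, add_zero, smul_eq_mul]
  exact Measure.eqOn_open_of_ae_eq h1 hW' (hG.comp (by fun_prop) fun z hz => hz.2)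
    (continuousOn_const.mul (hG.mono fun z hz => hz.1)) ⟨hz, hz'⟩

lemma summable_floquetTerm {ϖ : Set ℂ} (h : IsPeriodicCell ϖ)
    (hnull : volume (periodicDomain ϖ \ ⋃ m : ℤ × ℤ, cellTranslate ϖ m) = 0)
    (f : L2 (periodicDomain ϖ)) : Summable fun m => floquetTerm h f m :=
  ((orthogonalFamily_termL ϖ).summable_iff_norm_sq_summable fun m => shift h m f).2
    (hasSum_norm_sq_shift h hnull f).summable

/-- The values of the Floquet transform of a Bergman function extend analytically and
quasiperiodically. -/
lemma ae_tsum_floquetTerm_mem_bergmanExt {ϖ : Set ℂ} (h : IsPeriodicCell ϖ)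
    (hnull : volume (periodicDomain ϖ \ ⋃ m : ℤ × ℤ, cellTranslate ϖ m) = 0)
    {f : L2 (periodicDomain ϖ)} (hf : f ∈ bergmanSpace (periodicDomain ϖ)) :
    ∀ᵐ η ∂(volume.restrict floquetBox),
      (∑' m, floquetTerm h f m : BochnerL2 ϖ) η ∈ bergmanExt ϖ η := by
  set W := cellNhd ϖ with hWdef
  have hWo : IsOpen W := isOpen_cellNhd ϖ
  have hϖW : ∀ z ∈ ϖ, z + 0 ∈ W := fun z hz => by
    rw [add_zero]
    exact ⟨h.subset_periodicDomain hz,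
      closure_unitSquare_subset_bigSquare (subset_closure (h.subset_square hz))⟩
  obtain ⟨S, hS⟩ : Summable fun m => termL W m (nhdShift ϖ m f) :=
    ((orthogonalFamily_termL W).summable_iff_norm_sq_summable _).2
      (summable_norm_sq_nhdShift h hnull f)
  have hmem := ae_mem_of_hasSum_termL (isClosed_bergmanSpace hWo)
    (fun m => translateL_mem_bergmanSpace _ hf) hS
  have hres : ∀ᵐ η ∂(volume.restrict floquetBox),
      (∑' m, floquetTerm h f m : BochnerL2 ϖ) η = translateL 0 hϖW (S η) := by
    have h1 := hasSum_compLpL_termL (translateL 0 hϖW) hS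
    have h2 : ∀ m, translateL 0 hϖW (nhdShift ϖ m f) = shift h m f := fun m =>
      translateL_translateL _ _ (fun z hz => h.translate_subset m (mem_image_of_mem _ hz))
        (zero_add _).symm f
    simp only [h2] at h1
    rw [show (∑' m, floquetTerm h f m : BochnerL2 ϖ) = _ from h1.tsum_eq]
    exact (translateL 0 hϖW).coeFn_compLpL S
  -- Quasiperiodicity is compared on the overlap of `W` with its translate. Since `W` contains the
  -- part of `Ω` in the closed square, the overlap contains the edge points needed below.
  have hper : ∀ e : ℤ × ℤ, ∀ᵐ η ∂(volume.restrict floquetBox),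
      translateL (D' := {z | z ∈ W ∧ z + latticePt e ∈ W}) (latticePt e) (fun _ hz => hz.2) (S η) =
      exp ((phase η e : ℂ) * I) • translateL (D' := {z | z ∈ W ∧ z + latticePt e ∈ W}) 0
        (fun z hz => by simpa using hz.1) (S η) := fun e => by
    refine ae_eq_of_hasSum_termL _ _ e (fun m => ?_) hS
    have h3 : ∀ z ∈ {z | z ∈ W ∧ z + latticePt e ∈ W}, z + latticePt (m + e) ∈ periodicDomain ϖ :=
      fun z hz => add_mem_periodicDomain _ hz.1.1
    exact (translateL_translateL _ _ h3 (by rw [latticePt_add, add_comm]) f).trans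
      (translateL_translateL _ _ h3 (zero_add _).symm f).symm
  filter_upwards [hmem, hres, hper (1, 0), hper (0, 1)] with η h1 h2 h3 h4
  rw [h2]
  have hcl : ∀ z ∈ periodicDomain ϖ, z.re ∈ Icc (0 : ℝ) 1 → z.im ∈ Icc (0 : ℝ) 1 → z ∈ W :=
    fun z hz hz1 hz2 => ⟨hz, closure_unitSquare_subset_bigSquare
      (mem_closure_unitSquare.2 ⟨hz1, hz2⟩)⟩
  refine ⟨translateL_mem_bergmanSpace _ h1, W, analyticRep W (S η), hWo,
    fun z hz => ⟨hz.2, closure_unitSquare_subset_bigSquare (closure_mono h.subset_square hz.1)⟩,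
    inter_subset_left, differentiableOn_analyticRep h1, ?_, ?_, ?_⟩
  · filter_upwards [translateL_congr hϖW (ae_eq_analyticRep h1)] with z hz
    rw [hz, add_zero]
  · intro y hy hyΩ
    have h5 : (y : ℂ) * I + latticePt (1, 0) ∈ periodicDomain ϖ := add_mem_periodicDomain _ hyΩ
    have h6 := analyticRep_add_eq hWo h1 h3
      (hcl _ hyΩ (by simp) (by simpa using ⟨hy.1.le, hy.2.le⟩))
      (hcl _ h5 (by simp) (by simpa using ⟨hy.1.le, hy.2.le⟩))
    simpa [latticePt, phase, add_comm] using h6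
  · intro x hx hxΩ
    have h5 : (x : ℂ) + latticePt (0, 1) ∈ periodicDomain ϖ := add_mem_periodicDomain _ hxΩ
    have h6 := analyticRep_add_eq hWo h1 h4
      (hcl _ hxΩ (by simpa using ⟨hx.1.le, hx.2.le⟩) (by simp))
      (hcl _ h5 (by simpa using ⟨hx.1.le, hx.2.le⟩) (by simp))
    simpa [latticePt, phase] using h6

/-- The Floquet transform as an isometry into the Bochner space. -/
noncomputable def floquetIsometry {ϖ : Set ℂ} (h : IsPeriodicCell ϖ)
    (hnull : volume (periodicDomain ϖ \ ⋃ m : ℤ × ℤ, cellTranslate ϖ m) = 0) :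
    bergmanSpace (periodicDomain ϖ) →ₗᵢ[ℂ] BochnerL2 ϖ where
  toFun f := ∑' m, floquetTerm h (f : L2 (periodicDomain ϖ)) m
  map_add' f g := by
    rw [← (summable_floquetTerm h hnull _).tsum_add (summable_floquetTerm h hnull _)]
    refine tsum_congr fun m => ?_
    change termL ϖ m (shift h m _) = termL ϖ m (shift h m _) + termL ϖ m (shift h m _)
    rw [← map_add, shift_eq_translateL, shift_eq_translateL, shift_eq_translateL, ← map_add]
    rfl
  map_smul' c f := by
    rw [RingHom.id_apply, ← (summable_floquetTerm h hnull _).tsum_const_smul]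
    refine tsum_congr fun m => ?_
    change termL ϖ m (shift h m _) = c • termL ϖ m (shift h m _)
    rw [← map_smul, shift_eq_translateL, shift_eq_translateL, ← map_smul]
    rfl
  norm_map' f := by
    have hs := hasSum_norm_sq_shift h hnull (f : L2 (periodicDomain ϖ))
    have hmem : Memℓp (fun m => shift h m (f : L2 (periodicDomain ϖ))) 2 :=
      memℓp_gen (by simpa using hs.summable)
    -- The series is the image of the sequence of shifts under the isometry from the `ℓ²` direct sum
    -- attached to the orthogonal family.
    have h1 := (orthogonalFamily_termL ϖ).linearIsometry.norm_map ⟨_, hmem⟩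
    have h2 := lp.norm_rpow_eq_tsum (p := 2) (by norm_num)
      (⟨_, hmem⟩ : lp (fun _ : ℤ × ℤ => L2 ϖ) 2)
    simp only [ENNReal.toReal_ofNat, Real.rpow_ofNat, hs.tsum_eq] at h2
    refine h1.trans ?_
    exact (sq_eq_sq₀ (norm_nonneg _) (norm_nonneg _)).1 h2

lemma hasSum_floquetIsometry {ϖ : Set ℂ} (h : IsPeriodicCell ϖ)
    (hnull : volume (periodicDomain ϖ \ ⋃ m : ℤ × ℤ, cellTranslate ϖ m) = 0)
    (f : bergmanSpace (periodicDomain ϖ)) :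
    HasSum (fun m => floquetTerm h (f : L2 (periodicDomain ϖ)) m) (floquetIsometry h hnull f) :=
  (summable_floquetTerm h hnull _).hasSum

lemma floquetIsometry_mem {ϖ : Set ℂ} (h : IsPeriodicCell ϖ)
    (hnull : volume (periodicDomain ϖ \ ⋃ m : ℤ × ℤ, cellTranslate ϖ m) = 0)
    (f : bergmanSpace (periodicDomain ϖ)) : floquetIsometry h hnull f ∈ bochnerBergman ϖ :=
  (ae_tsum_floquetTerm_mem_bergmanExt h hnull f.2).mono fun _ hη => bergmanExt_le_bergmanEta _ _ hη

/-! ### Summable analytic partitions of unity from condition `(𝒜)` -/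

/-- Convergence of the two-dimensional Eisenstein-type sum; this is where the exponent must exceed
2. -/
lemma summable_norm_rpow_lattice {b : ℝ} (hb : 2 < b) :
    Summable fun m : ℤ × ℤ => ‖m‖ ^ (-b) := by
  rw [← (finTwoArrowEquiv ℤ).summable_iff]
  refine (EisensteinSeries.summable_one_div_norm_rpow hb).congr fun x => ?_
  congr 1
  simp [Pi.norm_def, Prod.norm_def, Finset.univ_fin2]

lemma norm_lattice_le {z : ℂ} (hz : z ∈ unitSquare) (m : ℤ × ℤ) :
    ‖m‖ ≤ 1 + ‖z + latticePt m‖ := by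
  obtain ⟨⟨h1, h2⟩, h3, h4⟩ := hz
  have k1 := abs_le.1 (abs_re_le_norm (z + latticePt m))
  have k2 := abs_le.1 (abs_im_le_norm (z + latticePt m))
  simp only [add_re, add_im, latticePt_re, latticePt_im] at k1 k2
  rw [Prod.norm_def, sup_le_iff, Int.norm_eq_abs, Int.norm_eq_abs, abs_le, abs_le]
  refine ⟨⟨?_, ?_⟩, ?_, ?_⟩ <;> linarith [k1.1, k1.2, k2.1, k2.2]

lemma periodic_latticePt {φ : ℂ → ℂ} (h1 : ∀ z, φ (z + 1) = φ z) (h2 : ∀ z, φ (z + I) = φ z)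
    (m : ℤ × ℤ) (z : ℂ) : φ (z + latticePt m) = φ z := by
  have h3 : Function.Periodic φ 1 := h1
  have h4 : Function.Periodic φ I := h2
  rw [latticePt, ← add_assoc, h4.int_mul m.2, ← mul_one (m.1 : ℂ), h3.int_mul m.1]

lemma sub_latticePt_floorIdx_mem (z : ℂ) : z - latticePt (floorIdx z) ∈ closure unitSquare := by
  rw [mem_closure_unitSquare]
  simp only [sub_re, sub_im, latticePt_re, latticePt_im, floorIdx, mem_Icc]
  exact ⟨⟨by linarith [Int.floor_le z.re], by linarith [Int.lt_floor_add_one z.re]⟩,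
    by linarith [Int.floor_le z.im], by linarith [Int.lt_floor_add_one z.im]⟩

lemma isCompact_closure_unitSquare : IsCompact (closure unitSquare) := by
  rw [closure_unitSquare]; exact isCompact_Icc.reProdIm isCompact_Icc

/-- Doubly periodic functions continuous on the closure of `Ω` are bounded on `Ω`. -/
lemma exists_norm_le_of_periodic {ϖ : Set ℂ} {q : ℂ → ℂ}
    (hq : ContinuousOn q (closure (periodicDomain ϖ)))
    (hper : ∀ m z, q (z + latticePt m) = q z) :
    ∃ M, 0 ≤ M ∧ ∀ z ∈ periodicDomain ϖ, ‖q z‖ ≤ M := by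
  obtain ⟨M, hM⟩ := (isCompact_closure_unitSquare.inter_left isClosed_closure).exists_bound_of_continuousOn
    (hq.mono inter_subset_left)
  refine ⟨max M 0, le_max_right _ _, fun z hz => le_max_of_le_left ?_⟩
  have h1 := hper (floorIdx z) (z - latticePt (floorIdx z))
  rw [sub_add_cancel] at h1
  rw [h1]
  exact hM _ ⟨subset_closure (sub_mem_periodicDomain _ hz), sub_latticePt_floorIdx_mem z⟩

/-- The function `1 / φ` is analytic on the closure of `Ω` if `φ` has no zeros there. -/
lemma analyticAt_inv_of_not_pos {φ : ℂ → ℂ} {z : ℂ} (hφ : MeromorphicNFAt φ z)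
    (h : ¬ 0 < meromorphicOrderAt φ z) : AnalyticAt ℂ φ⁻¹ z := by
  rw [← (meromorphicNFAt_inv.2 hφ).meromorphicOrderAt_nonneg_iff_analyticAt, meromorphicOrderAt_inv]
  rw [not_lt] at h
  obtain ⟨n, hn⟩ := WithTop.ne_top_iff_exists.1 (ne_top_of_le_ne_top WithTop.zero_ne_top h)
  rw [← hn] at h ⊢
  have h' : n ≤ 0 := by exact_mod_cast h
  have : (0 : ℤ) ≤ -n := by omega
  exact_mod_cast this

/-- The function is `ϕ / φ`: by periodicity of `φ`, its translates sum to `φ / φ = 1`. Poles of `ϕ`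
in the square are harmless. With `T` the sum of the translates of nonzero index, `ϕ = φ - T`, and `1
- T / φ` is analytic because neither `T` nor `1 / φ` has a pole in the part of `Ω` in the open
square. -/
theorem exists_analytic_partition {ϖ : Set ℂ} (h : IsPeriodicCell ϖ)
    (hA : ConditionA (periodicDomain ϖ)) :
    ∃ (ψ : ℂ → ℂ) (c : ℤ × ℤ → ℝ), DifferentiableOn ℂ ψ (periodicDomain ϖ) ∧ Summable c ∧
      (∀ m, ∀ z ∈ ϖ, ‖ψ (z + latticePt m)‖ ≤ c m) ∧
      ∀ z ∈ ϖ, HasSum (fun m => ψ (z + latticePt m)) 1 := by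
  classical
  obtain ⟨φ, ϕ, hφ, hφ1, hφ2, hφ0, hϕ, hfin, hpole, hsum, b, hb, d, hd⟩ := hA
  set Ω := periodicDomain ϖ with hΩ
  have hΩo : IsOpen Ω := isOpen_periodicDomain ϖ
  have hinv : ∀ z ∈ closure Ω, AnalyticAt ℂ φ⁻¹ z := fun z hz =>
    analyticAt_inv_of_not_pos (hφ (mem_univ z)) fun h0 => hφ0 z h0 hz
  have hper := periodic_latticePt hφ1 hφ2
  obtain ⟨M, hM0, hM⟩ := exists_norm_le_of_periodic (ϖ := ϖ) (q := φ⁻¹)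
    (fun z hz => (hinv z hz).continuousAt.continuousWithinAt)
    (fun m z => by simp only [Pi.inv_apply, hper])
  -- The constant `d` is not assumed nonnegative, hence `|d|`. At `m = 0` only nonnegativity of `u`
  -- is used.
  set u : ℤ × ℤ → ℝ := fun m => |d| * ‖m‖ ^ (-b) with hu
  have hu0 : ∀ m, 0 ≤ u m := fun m => by positivity
  have hus : Summable u := (summable_norm_rpow_lattice hb).mul_left _
  have hϕan : ∀ z, z ∉ poles ϕ → AnalyticAt ℂ ϕ z := fun z hz =>
    (hϕ (mem_univ z)).meromorphicOrderAt_nonneg_iff_analyticAt.1 (not_lt.1 hz)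
  set v : ℤ × ℤ → ℂ → ℂ := fun m z => if m = 0 then 0 else ϕ (z + latticePt m) with hv
  have hvu : ∀ m, ∀ z ∈ Ω ∩ unitSquare, ‖v m z‖ ≤ u m := by
    intro m z hz
    by_cases hm : m = 0
    · simp only [hv, if_pos hm, norm_zero]; exact hu0 m
    · simp only [hv, if_neg hm]
      have h1 := hd (z + latticePt m)
        ⟨add_mem_periodicDomain m hz.1, add_notMem_closure_unitSquare hz.2 hm⟩
      have h2 : 0 < ‖m‖ := norm_pos_iff.2 hm
      have h3 : ‖m‖ ^ b * ‖ϕ (z + latticePt m)‖ ≤ |d| := by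
        refine le_trans ?_ (h1.trans (le_abs_self d))
        gcongr
        exact norm_lattice_le hz.2 m
      have h4 : 0 < ‖m‖ ^ b := Real.rpow_pos_of_pos h2 b
      rw [hu]
      simp only
      rw [Real.rpow_neg h2.le, ← div_eq_mul_inv, le_div_iff₀ h4, mul_comm]
      exact h3
  have hvs : ∀ z ∈ Ω ∩ unitSquare, Summable fun m => v m z := fun z hz =>
    Summable.of_norm_bounded hus fun m => hvu m z hz
  set T : ℂ → ℂ := fun z => ∑' m, v m z
  have hTd : DifferentiableOn ℂ T (Ω ∩ unitSquare) := by
    refine differentiableOn_tsum_of_summable_norm hus (fun m => ?_)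
      (hΩo.inter isOpen_unitSquare) hvu
    by_cases hm : m = 0
    · simp only [hv, if_pos hm]; exact differentiableOn_const 0
    · simp only [hv, if_neg hm]
      intro z hz
      have h1 : z + latticePt m ∉ poles ϕ := fun h2 =>
        add_notMem_closure_unitSquare hz.2 hm (subset_closure (hpole h2))
      exact ((hϕan _ h1).differentiableAt.comp z
        (differentiableAt_id.add_const _)).differentiableWithinAt
  have hTn : ∀ z ∈ Ω ∩ unitSquare, ‖T z‖ ≤ ∑' m, u m := fun z hz =>
    tsum_of_norm_bounded hus.hasSum fun m => hvu m z hz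
  have hφT : ∀ z ∈ Ω ∩ unitSquare, z ∉ poles ϕ → φ z = ϕ z + T z := by
    intro z hz hzp
    have h1 : HasSum (fun m => ϕ (z + latticePt m)) (φ z) := by
      rw [← (Equiv.neg (ℤ × ℤ)).hasSum_iff]
      simp only [Function.comp_def, Equiv.neg_apply, latticePt_neg, ← sub_eq_add_neg]
      refine hsum z fun m => ?_
      by_cases hm : m = 0
      · simpa [hm] using hzp
      · intro h2
        refine add_notMem_closure_unitSquare hz.2 (m := -m) (by simpa using hm) ?_
        rw [latticePt_neg, ← sub_eq_add_neg]
        exact subset_closure (hpole h2)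
    have h2 : HasSum (fun m => ϕ (z + latticePt m)) (ϕ z + T z) := by
      refine ((hasSum_ite_eq (0 : ℤ × ℤ) (ϕ z)).add (hvs z hz).hasSum).congr_fun fun m => ?_
      by_cases hm : m = 0
      · simp [hm, hv]
      · simp [hm, hv]
    exact h1.unique h2
  -- Inside the square the regularised formula; elsewhere the plain quotient, since `ϕ` has no poles
  -- there.
  set ψ : ℂ → ℂ := fun z => if z ∈ unitSquare then 1 - (φ z)⁻¹ * T z else ϕ z * (φ z)⁻¹ with hψ
  have hϖ : ∀ z ∈ ϖ, z ∈ Ω ∩ unitSquare := fun z hz =>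
    ⟨h.subset_periodicDomain hz, h.subset_square hz⟩
  have hψ0 : ∀ z ∈ ϖ, ψ z = 1 - (φ z)⁻¹ * T z := fun z hz => by
    simp only [hψ, if_pos (hϖ z hz).2]
  have hψm : ∀ z ∈ ϖ, ∀ m, m ≠ 0 → ψ (z + latticePt m) = v m z * (φ z)⁻¹ := fun z hz m hm => by
    have h1 : z + latticePt m ∉ unitSquare := fun h2 =>
      add_notMem_closure_unitSquare (hϖ z hz).2 hm (subset_closure h2)
    simp only [hψ, if_neg h1, hv, if_neg hm, hper]
  refine ⟨ψ, fun m => (if m = 0 then 1 + M * ∑' k, u k else 0) + M * u m, ?_,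
    (hasSum_ite_eq (0 : ℤ × ℤ) _).summable.add (hus.mul_left M), ?_, ?_⟩
  · intro z hz
    by_cases hzS : z ∈ unitSquare
    · have hn : Ω ∩ unitSquare ∈ nhds z := (hΩo.inter isOpen_unitSquare).mem_nhds ⟨hz, hzS⟩
      have h1 : DifferentiableAt ℂ (fun z => 1 - φ⁻¹ z * T z) z :=
        (differentiableAt_const 1).sub
          ((hinv z (subset_closure hz)).differentiableAt.mul (hTd.differentiableAt hn))
      refine (h1.congr_of_eventuallyEq ?_).differentiableWithinAt
      filter_upwards [hn] with w hw
      simp only [hψ, if_pos hw.2, Pi.inv_apply]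
    · have hzp : z ∉ poles ϕ := fun h1 => hzS (hpole h1)
      have h1 : DifferentiableAt ℂ (fun z => ϕ z * φ⁻¹ z) z :=
        (hϕan z hzp).differentiableAt.mul (hinv z (subset_closure hz)).differentiableAt
      refine (h1.congr_of_eventuallyEq ?_).differentiableWithinAt
      -- The value of `φ` can vanish in `Ω` only at its poles, by the normal form convention. These
      -- are isolated, and at `z` itself the quotient formula holds by definition, so a punctured
      -- neighbourhood suffices to match the two formulas across the edge.
      have h2 : ∀ᶠ w in nhdsWithin z {z}ᶜ, φ w ≠ 0 := by
        refine (meromorphicOrderAt_ne_top_iff_eventually_ne_zero (hφ (mem_univ z)).meromorphicAt).1 ?_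
        intro h3
        exact hφ0 z (by rw [h3]; exact WithTop.top_pos) (subset_closure hz)
      rw [eventually_nhdsWithin_iff] at h2
      filter_upwards [h2, hΩo.mem_nhds hz, hfin.isClosed.isOpen_compl.mem_nhds hzp]
        with w h3 h4 h5
      by_cases hwS : w ∈ unitSquare
      · have h6 : φ w ≠ 0 := h3 (by rintro rfl; exact hzS hwS)
        simp only [hψ, if_pos hwS, Pi.inv_apply]
        have h7 := hφT w ⟨h4, hwS⟩ h5
        field_simp
        rw [h7]; ring
      · simp only [hψ, if_neg hwS, Pi.inv_apply]
  · intro m z hz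
    have h1 : ‖(φ z)⁻¹‖ ≤ M := hM z (hϖ z hz).1
    by_cases hm : m = 0
    · subst hm
      simp only [latticePt_zero, add_zero, if_pos]
      rw [hψ0 z hz]
      calc ‖1 - (φ z)⁻¹ * T z‖ ≤ ‖(1 : ℂ)‖ + ‖(φ z)⁻¹ * T z‖ := norm_sub_le _ _
        _ ≤ 1 + M * ∑' k, u k := by
            rw [norm_one, norm_mul]
            gcongr
            exact hTn z (hϖ z hz)
        _ ≤ _ := le_add_of_nonneg_right (mul_nonneg hM0 (hu0 0))
    · simp only [if_neg hm, zero_add]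
      rw [hψm z hz m hm, norm_mul, mul_comm]
      exact mul_le_mul h1 (hvu m z (hϖ z hz)) (norm_nonneg _) hM0
  · intro z hz
    have h1 := (hasSum_ite_eq (0 : ℤ × ℤ) (1 - (φ z)⁻¹ * T z)).add
      ((hvs z (hϖ z hz)).hasSum.mul_right (φ z)⁻¹)
    rw [mul_comm _ (φ z)⁻¹, sub_add_cancel] at h1
    refine h1.congr_fun fun m => ?_
    by_cases hm : m = 0
    · simp [hm, hψ0 z hz, hv]
    · rw [hψm z hz m hm, if_neg hm, zero_add]

/-! ### Quasiperiodic extensions -/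

open Filter Topology in
-- The endpoints are included so that corners of the square, where no boundary condition is imposed,
-- are reached as limits of edge points.
lemma frequently_mem_Ioo {y : ℝ} (hy : y ∈ Icc (0 : ℝ) 1) : ∃ᶠ t in 𝓝[≠] y, t ∈ Ioo (0 : ℝ) 1 := by
  rcases lt_or_eq_of_le hy.2 with h | h
  · have h1 : ∀ᶠ t in 𝓝[>] y, t ∈ Ioo (0 : ℝ) 1 := by
      filter_upwards [Ioo_mem_nhdsGT h] with t ht using ⟨hy.1.trans_lt ht.1, ht.2⟩
    exact h1.frequently.filter_mono (nhdsWithin_mono _ fun t ht => ne_of_gt ht)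
  · subst h
    have h1 : ∀ᶠ t in 𝓝[<] (1 : ℝ), t ∈ Ioo (0 : ℝ) 1 := Ioo_mem_nhdsLT zero_lt_one
    exact h1.frequently.filter_mono (nhdsWithin_mono _ fun t ht => ne_of_lt ht)

open Filter Topology in
/-- Identity theorem along an edge of the unit square. -/
lemma eventually_eq_of_eq_on_edge {Ω : Set ℂ} (hΩ : IsOpen Ω) {F₁ F₂ : ℂ → ℂ} {a : ℂ} (ha : a ≠ 0)
    {y : ℝ} (hy : y ∈ Icc (0 : ℝ) 1) (hyΩ : (y : ℂ) * a ∈ Ω) (h₁ : AnalyticAt ℂ F₁ (y * a))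
    (h₂ : AnalyticAt ℂ F₂ (y * a))
    (h : ∀ t ∈ Ioo (0 : ℝ) 1, (t : ℂ) * a ∈ Ω → F₁ (t * a) = F₂ (t * a)) :
    ∀ᶠ z in 𝓝 ((y : ℂ) * a), F₁ z = F₂ z := by
  refine (h₁.frequently_eq_iff_eventually_eq h₂).1 ?_
  have hc : Continuous fun t : ℝ => (t : ℂ) * a := by fun_prop
  have ht : Tendsto (fun t : ℝ => (t : ℂ) * a) (𝓝[≠] y) (𝓝[≠] ((y : ℂ) * a)) := by
    refine (hc.tendsto y).inf (tendsto_principal_principal.2 fun t ht => ?_)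
    intro h'
    exact ht (by simpa [ha] using h')
  refine ht.frequently ?_
  have h3 : ∀ᶠ t : ℝ in 𝓝[≠] y, (t : ℂ) * a ∈ Ω :=
    ((hc.tendsto y).eventually (hΩ.mem_nhds hyΩ)).filter_mono nhdsWithin_le_nhds
  exact ((frequently_mem_Ioo hy).and_eventually h3).mono fun t ht => h t ht.1 ht.2

/-- The quasiperiodic extension of a function from the unit square. -/
noncomputable def quasiExt (η : ℝ × ℝ) (G : ℂ → ℂ) (z : ℂ) : ℂ :=
  exp ((phase η (floorIdx z) : ℂ) * I) * G (z - latticePt (floorIdx z))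

lemma quasiExt_add (η : ℝ × ℝ) (G : ℂ → ℂ) (z : ℂ) (m : ℤ × ℤ) :
    quasiExt η G (z + latticePt m) = exp ((phase η m : ℂ) * I) * quasiExt η G z := by
  rw [quasiExt, quasiExt, floorIdx_add, phase_add, latticePt_add, add_sub_add_right_eq_sub,
    ← mul_assoc, ← exp_add]
  push_cast
  ring_nf

lemma quasiExt_of_mem_unitSquare (η : ℝ × ℝ) (G : ℂ → ℂ) {z : ℂ} (hz : z ∈ unitSquare) :
    quasiExt η G z = G z := by
  simp [quasiExt, floorIdx_of_mem_unitSquare hz]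

open Filter Topology in
-- A point of the half-open square has neighbouring cells only across the left and bottom edges.
-- There the extension uses values of `G` near the opposite edge, and the identity theorem upgrades
-- the edge conditions to identities on full neighbourhoods.
lemma quasiExt_eventuallyEq {ϖ : Set ℂ} (h : IsPeriodicCell ϖ) {η : ℝ × ℝ} {U : Set ℂ} {G : ℂ → ℂ}
    (hUo : IsOpen U) (hU : closure ϖ ∩ periodicDomain ϖ ⊆ U) (hG : DifferentiableOn ℂ G U)
    (h1 : ∀ y ∈ Ioo (0 : ℝ) 1, (y : ℂ) * I ∈ periodicDomain ϖ →
      G (1 + (y : ℂ) * I) = exp ((η.1 : ℂ) * I) * G ((y : ℂ) * I))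
    (h2 : ∀ x ∈ Ioo (0 : ℝ) 1, (x : ℂ) ∈ periodicDomain ϖ →
      G ((x : ℂ) + I) = exp ((η.2 : ℂ) * I) * G (x : ℂ))
    {z₀ : ℂ} (hz₀ : z₀ ∈ periodicDomain ϖ) (hf : floorIdx z₀ = 0) :
    quasiExt η G =ᶠ[𝓝 z₀] G := by
  have hΩ := isOpen_periodicDomain ϖ
  have han : ∀ z ∈ periodicDomain ϖ, z ∈ closure unitSquare → AnalyticAt ℂ G z := fun z hz hz' =>
    hG.analyticAt (hUo.mem_nhds (hU ⟨h.mem_closure hz hz', hz⟩))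
  have hadd : ∀ (m : ℤ × ℤ) (z : ℂ), z ∈ periodicDomain ϖ → z + latticePt m ∈ closure unitSquare →
      AnalyticAt ℂ (fun w => G (w + latticePt m)) z := fun m z hz hz' =>
    AnalyticAt.fun_comp (han _ (add_mem_periodicDomain m hz) hz') (by fun_prop)
  have hl1 : latticePt (1, 0) = 1 := by simp [latticePt]
  have hl2 : latticePt (0, 1) = I := by simp [latticePt]
  have e1 : ∀ z ∈ periodicDomain ϖ, z.re = 0 → z.im ∈ Icc (0 : ℝ) 1 →
      ∀ᶠ w in 𝓝 z, G (w + 1) = exp ((η.1 : ℂ) * I) * G w := by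
    intro z hz hre him
    have hzy : (z.im : ℂ) * I = z := by
      apply Complex.ext <;> simp [hre]
    have k1 := hadd (1, 0) z hz (mem_closure_unitSquare.2 (by simpa [hre] using him))
    have k2 := han z hz (mem_closure_unitSquare.2 (by simpa [hre] using him))
    rw [hl1] at k1
    have := eventually_eq_of_eq_on_edge hΩ I_ne_zero him (by rwa [hzy])
      (by rw [hzy]; exact k1)
      (F₂ := fun w => exp ((η.1 : ℂ) * I) * G w) (by rw [hzy]; exact analyticAt_const.mul k2)
      (fun t ht htΩ => by rw [add_comm]; exact h1 t ht htΩ)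
    rwa [hzy] at this
  have e2 : ∀ z ∈ periodicDomain ϖ, z.im = 0 → z.re ∈ Icc (0 : ℝ) 1 →
      ∀ᶠ w in 𝓝 z, G (w + I) = exp ((η.2 : ℂ) * I) * G w := by
    intro z hz him hre
    have hzx : (z.re : ℂ) * 1 = z := by
      apply Complex.ext <;> simp [him]
    have k1 := hadd (0, 1) z hz (mem_closure_unitSquare.2 (by simpa [him] using hre))
    have k2 := han z hz (mem_closure_unitSquare.2 (by simpa [him] using hre))
    rw [hl2] at k1
    have := eventually_eq_of_eq_on_edge hΩ one_ne_zero hre (by rwa [hzx])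
      (by rw [hzx]; exact k1)
      (F₂ := fun w => exp ((η.2 : ℂ) * I) * G w) (by rw [hzx]; exact analyticAt_const.mul k2)
      (fun t ht htΩ => by rw [mul_one] at htΩ ⊢; exact h2 t ht htΩ)
    rwa [hzx] at this
  have hfl : (0 ≤ z₀.re ∧ z₀.re < 1) ∧ 0 ≤ z₀.im ∧ z₀.im < 1 := by
    have := Prod.ext_iff.1 hf
    simpa only [floorIdx, Prod.fst_zero, Prod.snd_zero, Int.floor_eq_zero_iff, mem_Ico] using this
  obtain ⟨⟨a1, a2⟩, a3, a4⟩ := hfl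
  have cre : Tendsto Complex.re (𝓝 z₀) (𝓝 z₀.re) := continuous_re.tendsto z₀
  have cim : Tendsto Complex.im (𝓝 z₀) (𝓝 z₀.im) := continuous_im.tendsto z₀
  have hre : ∀ᶠ z in 𝓝 z₀, ⌊z.re⌋ = 0 ∨
      (⌊z.re⌋ = -1 ∧ z₀.re = 0 ∧ G (z + 1) = exp ((η.1 : ℂ) * I) * G z ∧
        (z₀.im = 0 → G (z + I + 1) = exp ((η.1 : ℂ) * I) * G (z + I))) := by
    rcases a1.eq_or_lt with h0 | h0
    · have k1 := e1 z₀ hz₀ h0.symm ⟨a3, a4.le⟩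
      -- At the corner `0` the diagonal cell is reached by two crossings, so the horizontal relation
      -- is also needed near `I`.
      have k2 : ∀ᶠ z in 𝓝 z₀, z₀.im = 0 → G (z + I + 1) = exp ((η.1 : ℂ) * I) * G (z + I) := by
        by_cases h3 : z₀.im = 0
        · have k3 := e1 (z₀ + I) (by rw [← hl2]; exact add_mem_periodicDomain _ hz₀)
            (by simp [← h0]) (by simp [h3])
          have k4 : Tendsto (fun z : ℂ => z + I) (𝓝 z₀) (𝓝 (z₀ + I)) :=
            (continuous_add_const I).tendsto z₀
          filter_upwards [k4.eventually k3] with z hz _ using hz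
        · exact .of_forall fun z h4 => absurd h4 h3
      filter_upwards [k1, k2, cre.eventually (Ioo_mem_nhds (show (-1 : ℝ) < z₀.re by linarith) a2)]
        with z k3 k4 k5
      rcases le_or_gt 0 z.re with h5 | h5
      · exact Or.inl (Int.floor_eq_zero_iff.2 ⟨h5, k5.2⟩)
      · refine Or.inr ⟨Int.floor_eq_iff.2 ⟨?_, ?_⟩, h0.symm, k3, k4⟩ <;> push_cast <;>
          linarith [k5.1]
    · filter_upwards [cre.eventually (Ioo_mem_nhds h0 a2)] with z k5
      exact Or.inl (Int.floor_eq_zero_iff.2 ⟨k5.1.le, k5.2⟩)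
  have him : ∀ᶠ z in 𝓝 z₀, ⌊z.im⌋ = 0 ∨
      (⌊z.im⌋ = -1 ∧ z₀.im = 0 ∧ G (z + I) = exp ((η.2 : ℂ) * I) * G z) := by
    rcases a3.eq_or_lt with h0 | h0
    · have k1 := e2 z₀ hz₀ h0.symm ⟨a1, a2.le⟩
      filter_upwards [k1, cim.eventually (Ioo_mem_nhds (show (-1 : ℝ) < z₀.im by linarith) a4)]
        with z k3 k5
      rcases le_or_gt 0 z.im with h5 | h5
      · exact Or.inl (Int.floor_eq_zero_iff.2 ⟨h5, k5.2⟩)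
      · refine Or.inr ⟨Int.floor_eq_iff.2 ⟨?_, ?_⟩, h0.symm, k3⟩ <;> push_cast <;>
          linarith [k5.1]
    · filter_upwards [cim.eventually (Ioo_mem_nhds h0 a4)] with z k5
      exact Or.inl (Int.floor_eq_zero_iff.2 ⟨k5.1.le, k5.2⟩)
  have hcancel : ∀ (x : ℝ) (c : ℂ), exp (-((x : ℂ) * I)) * (exp ((x : ℂ) * I) * c) = c :=
    fun x c => by rw [← mul_assoc, ← exp_add, neg_add_cancel, exp_zero, one_mul]
  filter_upwards [hre, him] with z hr hi
  rcases hr with hr | ⟨hr, -, hr1, hr2⟩ <;> rcases hi with hi | ⟨hi, hi0, hi1⟩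
  · simp [quasiExt, floorIdx, hr, hi, phase, latticePt]
  · simp [quasiExt, floorIdx, hr, hi, phase, latticePt, hi1, hcancel]
  · simp [quasiExt, floorIdx, hr, hi, phase, latticePt, hr1, hcancel]
  · have : z - latticePt (-1, -1) = z + I + 1 := by simp [latticePt]; ring
    rw [quasiExt, show floorIdx z = (-1, -1) from Prod.ext hr hi, this, hr2 hi0, hi1]
    simp only [phase]
    push_cast
    rw [← mul_assoc, ← mul_assoc, ← exp_add, ← exp_add]
    ring_nf
    simp

/-- A lattice translation, which only multiplies by a constant, moves any point of `Ω` into the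
half-open square, where the extension is locally `G`. -/
lemma differentiableOn_quasiExt {ϖ : Set ℂ} (h : IsPeriodicCell ϖ) {η : ℝ × ℝ} {U : Set ℂ}
    {G : ℂ → ℂ} (hUo : IsOpen U) (hU : closure ϖ ∩ periodicDomain ϖ ⊆ U)
    (hG : DifferentiableOn ℂ G U)
    (h1 : ∀ y ∈ Ioo (0 : ℝ) 1, (y : ℂ) * I ∈ periodicDomain ϖ →
      G (1 + (y : ℂ) * I) = exp ((η.1 : ℂ) * I) * G ((y : ℂ) * I))
    (h2 : ∀ x ∈ Ioo (0 : ℝ) 1, (x : ℂ) ∈ periodicDomain ϖ →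
      G ((x : ℂ) + I) = exp ((η.2 : ℂ) * I) * G (x : ℂ)) :
    DifferentiableOn ℂ (quasiExt η G) (periodicDomain ϖ) := by
  intro z hz
  set n := floorIdx z
  have hz' : z - latticePt n ∈ periodicDomain ϖ := sub_mem_periodicDomain n hz
  have hfl : floorIdx (z - latticePt n) = 0 := by
    have := floorIdx_add z (-n)
    rwa [latticePt_neg, ← sub_eq_add_neg, add_neg_cancel] at this
  have hU' : z - latticePt n ∈ U := hU ⟨h.mem_closure hz' (sub_latticePt_floorIdx_mem z), hz'⟩
  have k1 : DifferentiableAt ℂ (quasiExt η G) (z - latticePt n) :=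
    (hG.differentiableAt (hUo.mem_nhds hU')).congr_of_eventuallyEq
      (quasiExt_eventuallyEq h hUo hU hG h1 h2 hz' hfl)
  have k2 : quasiExt η G = fun w => exp ((phase η n : ℂ) * I) * quasiExt η G (w - latticePt n) := by
    ext w
    rw [← quasiExt_add, sub_add_cancel]
  rw [k2]
  exact ((DifferentiableAt.comp (f := fun w => w - latticePt n) z k1
    (by fun_prop)).const_mul _).differentiableWithinAt

lemma tsum_enorm_ne_top {ι E : Type*} [SeminormedAddGroup E] {u : ι → E}
    (h : Summable fun i => ‖u i‖) : ∑' i, ‖u i‖ₑ ≠ ⊤ :=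
  ENNReal.tsum_coe_ne_top_iff_summable.2 (NNReal.summable_coe.1 h)

/-- Elements of `A²_{η,ext}(ϖ)` are values at `η` of Floquet series with summable terms. -/
lemma exists_hasSum_shift_of_mem_bergmanExt {ϖ : Set ℂ} (h : IsPeriodicCell ϖ)
    (hnull : volume (periodicDomain ϖ \ ⋃ m : ℤ × ℤ, cellTranslate ϖ m) = 0)
    (hA : ConditionA (periodicDomain ϖ)) {η : ℝ × ℝ} {v : L2 ϖ} (hv : v ∈ bergmanExt ϖ η) :
    ∃ f ∈ bergmanSpace (periodicDomain ϖ), Summable (fun m => ‖shift h m f‖) ∧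
      HasSum (fun m => exp (-(phase η m : ℂ) * I) • shift h m f) v := by
  obtain ⟨-, U, G, hUo, hU, -, hG, hvG, h1, h2⟩ := hv
  obtain ⟨ψ, c, hψ, hc, hψc, hψ1⟩ := exists_analytic_partition h hA
  set Ω := periodicDomain ϖ
  have hΩ : IsOpen Ω := isOpen_periodicDomain ϖ
  have hE := differentiableOn_quasiExt h hUo hU hG h1 h2
  -- On the cell with index `m` this is a unimodular constant times `v` times the translate of `ψ`.
  -- The constants cancel in the Floquet series at `η`, leaving `v` times a sum equal to 1.
  set f₀ : ℂ → ℂ := fun z => quasiExt η G z * ψ z with hf₀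
  have hf₀d : DifferentiableOn ℂ f₀ Ω := hE.mul hψ
  have hc0 : ∀ m, 0 ≤ c m := fun m =>
    (norm_nonneg _).trans (hψc m _ h.isConnected.nonempty.some_mem)
  have hval : ∀ m, ∀ z ∈ ϖ,
      f₀ (z + latticePt m) = exp ((phase η m : ℂ) * I) * G z * ψ (z + latticePt m) := by
    intro m z hz
    simp only [hf₀]
    rw [quasiExt_add, quasiExt_of_mem_unitSquare _ _ (h.subset_square hz)]
  have hbound : ∀ m, ∀ᵐ z ∂(volume.restrict ϖ), ‖f₀ (z + latticePt m)‖ ≤ c m * ‖v z‖ := by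
    intro m
    filter_upwards [hvG, ae_restrict_mem h.isOpen.measurableSet] with z h3 h4
    rw [hval m z h4, h3, norm_mul, norm_exp_ofReal_mul_I_mul, mul_comm]
    gcongr
    exact hψc m z h4
  have hmem : MemLp f₀ 2 (volume.restrict Ω) := by
    refine ⟨hf₀d.continuousOn.aestronglyMeasurable hΩ.measurableSet, ?_⟩
    rw [eLpNorm_lt_top_iff_lintegral_rpow_enorm_lt_top (by norm_num) (by norm_num)]
    simp only [ENNReal.toReal_ofNat, ENNReal.rpow_ofNat]
    rw [lintegral_periodicDomain h hnull (fun z => ‖f₀ z‖ₑ ^ 2)]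
    have h3 : ∀ m, ∫⁻ z in ϖ, ‖f₀ (z + latticePt m)‖ₑ ^ 2 ≤
        ENNReal.ofReal (c m ^ 2) * ‖v‖ₑ ^ 2 := by
      intro m
      rw [enorm_sq_eq_lintegral, ← lintegral_const_mul' _ _ ENNReal.ofReal_ne_top]
      refine lintegral_mono_ae ?_
      filter_upwards [hbound m] with z hz
      rw [ENNReal.ofReal_pow (hc0 m), ← mul_pow]
      gcongr
      rw [← ofReal_norm, ← ofReal_norm, ← ENNReal.ofReal_mul (hc0 m)]
      exact ENNReal.ofReal_le_ofReal hz
    refine (ENNReal.tsum_le_tsum h3).trans_lt ?_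
    rw [ENNReal.tsum_mul_right]
    refine ENNReal.mul_lt_top ?_ (ENNReal.pow_lt_top enorm_lt_top)
    -- Each `c m` is at most the total sum, so the squares are dominated by a multiple of `c`.
    have h4 : Summable fun m => c m ^ 2 := by
      refine Summable.of_nonneg_of_le (fun m => sq_nonneg _) (fun m => ?_)
        (hc.mul_left (∑' k, c k))
      rw [sq]
      exact mul_le_mul_of_nonneg_right (hc.le_tsum m fun k _ => hc0 k) (hc0 m)
    rw [← ENNReal.ofReal_tsum_of_nonneg (fun m => sq_nonneg _) h4]
    exact ENNReal.ofReal_lt_top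
  have hshift : ∀ m, shift h m (hmem.toLp f₀) =ᵐ[volume.restrict ϖ]
      fun z => f₀ (z + latticePt m) := fun m =>
    translateL_congr (fun z hz => h.translate_subset m (mem_image_of_mem _ hz)) hmem.coeFn_toLp
  have hnorm : ∀ m, ‖shift h m (hmem.toLp f₀)‖ ≤ c m * ‖v‖ := fun m => by
    refine Lp.norm_le_mul_norm_of_ae_le_mul ?_
    filter_upwards [hshift m, hbound m] with z h3 h4
    rw [h3]; exact h4
  have hsn : Summable fun m => ‖shift h m (hmem.toLp f₀)‖ :=
    Summable.of_nonneg_of_le (fun _ => norm_nonneg _) hnorm (hc.mul_right _)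
  have hsn' : Summable fun m => ‖exp (-(phase η m : ℂ) * I) • shift h m (hmem.toLp f₀)‖ := by
    refine hsn.congr fun m => ?_
    rw [norm_smul, ← ofReal_neg, norm_exp_ofReal_mul_I, one_mul]
  refine ⟨hmem.toLp f₀, ⟨f₀, hf₀d, hmem.coeFn_toLp⟩, hsn, ?_⟩
  have htop : ∑' m, ‖exp (-(phase η m : ℂ) * I) • shift h m (hmem.toLp f₀)‖ₑ ≠ ⊤ :=
    tsum_enorm_ne_top hsn'
  have hv : v = ∑' m, exp (-(phase η m : ℂ) * I) • shift h m (hmem.toLp f₀) := by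
    refine Lp.ext ?_
    filter_upwards [Lp.hasSum_coeFn_tsum htop, hvG, ae_restrict_mem h.isOpen.measurableSet,
      ae_all_iff.2 hshift, ae_all_iff.2 fun m => Lp.coeFn_smul (exp (-(phase η m : ℂ) * I))
        (shift h m (hmem.toLp f₀))] with z h3 h4 h5 h6 h7
    refine HasSum.unique ?_ h3
    have h8 := (hψ1 z h5).mul_left (G z)
    rw [mul_one] at h8
    rw [h4]
    refine h8.congr_fun fun m => ?_
    rw [h7, Pi.smul_apply, h6, hval m z h5, smul_eq_mul, ← mul_assoc, ← mul_assoc, ← exp_add,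
      neg_mul, neg_add_cancel, exp_zero, one_mul]
  rw [hv]
  exact hsn'.of_norm.hasSum

/-! ### Surjectivity and the inversion formula -/

/-- A Floquet series with summable terms has a continuous sum. -/
lemma exists_continuousMap_floquetIsometry {ϖ : Set ℂ} (h : IsPeriodicCell ϖ)
    (hnull : volume (periodicDomain ϖ \ ⋃ m : ℤ × ℤ, cellTranslate ϖ m) = 0)
    (f : bergmanSpace (periodicDomain ϖ))
    (hf : Summable fun m => ‖shift h m (f : L2 (periodicDomain ϖ))‖) :
    ∃ Φ : C(ℝ × ℝ, L2 ϖ), floquetIsometry h hnull f =ᵐ[volume.restrict floquetBox] Φ ∧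
      ∀ η, Φ η = ∑' m, ((1 / (2 * Real.pi) : ℂ) * exp (-(phase η m : ℂ) * I)) •
        shift h m (f : L2 (periodicDomain ϖ)) := by
  refine ⟨⟨fun η => ∑' m, ((1 / (2 * Real.pi) : ℂ) * exp (-(phase η m : ℂ) * I)) •
        shift h m (f : L2 (periodicDomain ϖ)), ?_⟩, ?_, fun η => rfl⟩
  · refine continuous_tsum (fun m => ?_) (hf.mul_left ‖(1 / (2 * Real.pi) : ℂ)‖) fun m η => ?_
    · have := continuous_phase m
      fun_prop
    · rw [norm_smul, norm_mul, ← ofReal_neg, norm_exp_ofReal_mul_I, mul_one]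
  · have h1 : ∑' m, ‖termL ϖ m (shift h m (f : L2 (periodicDomain ϖ)))‖ₑ ≠ ⊤ :=
      tsum_enorm_ne_top (by simpa only [LinearIsometry.norm_map] using hf)
    refine (Lp.coeFn_tsum h1).trans ?_
    filter_upwards [ae_all_iff.2 fun m =>
      coeFn_termL m (shift h m (f : L2 (periodicDomain ϖ)))] with η h2
    exact tsum_congr h2

/-- The Floquet transform intertwines translations and multiplication by characters. -/
lemma mulPhase_floquetIsometry {ϖ : Set ℂ} (h : IsPeriodicCell ϖ)
    (hnull : volume (periodicDomain ϖ \ ⋃ m : ℤ × ℤ, cellTranslate ϖ m) = 0)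
    (f : bergmanSpace (periodicDomain ϖ)) (k : ℤ × ℤ) :
    mulPhase ϖ k (floquetIsometry h hnull f) ∈ (floquetIsometry h hnull).toLinearMap.range := by
  have hk : ∀ z ∈ periodicDomain ϖ, z + latticePt k ∈ periodicDomain ϖ := fun z hz =>
    add_mem_periodicDomain k hz
  refine ⟨⟨translateL (latticePt k) hk f, translateL_mem_bergmanSpace hk f.2⟩, ?_⟩
  have h1 : HasSum (fun m => mulPhase ϖ k (termL ϖ m (shift h m (f : L2 (periodicDomain ϖ)))))
      (mulPhase ϖ k (floquetIsometry h hnull f)) :=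
    (mulPhase ϖ k).hasSum (hasSum_floquetIsometry h hnull f)
  rw [← (Equiv.addRight k).hasSum_iff] at h1
  simp only [Function.comp_def, mulPhase_termL, Equiv.coe_addRight, add_sub_cancel_right] at h1
  refine (hasSum_floquetIsometry h hnull _).unique (h1.congr_fun fun m => ?_)
  change termL ϖ m (shift h m _) = _
  rw [shift_eq_translateL, shift_eq_translateL]
  congr 1
  exact translateL_translateL _ _ _ (latticePt_add m k) _

/-- Orthogonality to all character multiples of the transform of `f`, which stay in the range, kills
every Fourier coefficient of the fibrewise inner product. -/
lemma ae_inner_eq_zero_of_mem_orthogonal {ϖ : Set ℂ} (h : IsPeriodicCell ϖ)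
    (hnull : volume (periodicDomain ϖ \ ⋃ m : ℤ × ℤ, cellTranslate ϖ m) = 0) {g : BochnerL2 ϖ}
    (hg : g ∈ ((floquetIsometry h hnull).toLinearMap.range)ᗮ)
    (f : bergmanSpace (periodicDomain ϖ)) {Φ : C(ℝ × ℝ, L2 ϖ)}
    (hΦ : floquetIsometry h hnull f =ᵐ[volume.restrict floquetBox] Φ) :
    ∀ᵐ η ∂(volume.restrict floquetBox), inner ℂ (Φ η) (g η) = 0 := by
  refine ae_eq_zero_of_forall_integral_exp_phase (s := fun η => inner ℂ (Φ η) (g η)) ?_ fun k => ?_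
  · obtain ⟨C, hC⟩ := isCompact_floquetBox.exists_bound_of_continuousOn Φ.continuous.continuousOn
    refine (Lp.memLp g).of_le_mul (c := C)
      (Φ.continuous.aestronglyMeasurable.inner (Lp.memLp g).1) ?_
    filter_upwards [ae_restrict_mem isCompact_floquetBox.measurableSet] with η hη
    refine (norm_inner_le_norm _ _).trans ?_
    gcongr
    exact hC η hη
  · have h1 := (Submodule.mem_orthogonal _ _).1 hg _ (mulPhase_floquetIsometry h hnull f (-k))
    rw [L2.inner_def] at h1
    rw [← h1]
    refine integral_congr_ae ?_
    filter_upwards [coeFn_mulPhase (-k) (floquetIsometry h hnull f), hΦ] with η h2 h3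
    rw [h2, h3, inner_smul_left, phase_neg, ofReal_neg, conj_exp_neg_mul_I]

/-- No nonzero element of `L²(𝐐; A²_η(ϖ))` is orthogonal to the range of the transform. -/
lemma eq_zero_of_mem_orthogonal {ϖ : Set ℂ} (h : IsPeriodicCell ϖ)
    (hnull : volume (periodicDomain ϖ \ ⋃ m : ℤ × ℤ, cellTranslate ϖ m) = 0)
    (hA : ConditionA (periodicDomain ϖ)) {g : BochnerL2 ϖ} (hgB : g ∈ bochnerBergman ϖ)
    (hg : g ∈ ((floquetIsometry h hnull).toLinearMap.range)ᗮ) : g = 0 := by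
  -- A finite exponent makes `L2 ϖ` separable, and with it the space of continuous maps in the
  -- compact-open topology.
  have : Fact ((2 : ℝ≥0∞) ≠ ⊤) := ⟨by norm_num⟩
  set E : Set C(ℝ × ℝ, L2 ϖ) :=
    {Φ | ∃ f, floquetIsometry h hnull f =ᵐ[volume.restrict floquetBox] Φ}
  obtain ⟨D, hDc, hD⟩ := TopologicalSpace.exists_countable_dense E
  -- The null set depends on `Φ`. A countable dense family gives a common one, and continuity of
  -- evaluation at `η` then recovers all of `E`.
  have h1 : ∀ᵐ η ∂(volume.restrict floquetBox), ∀ Φ ∈ D, inner ℂ (Φ.1 η) (g η) = 0 := by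
    rw [ae_ball_iff hDc]
    intro Φ _
    obtain ⟨f, hf⟩ := Φ.2
    exact ae_inner_eq_zero_of_mem_orthogonal h hnull hg f hf
  refine (Lp.eq_zero_iff_ae_eq_zero).2 ?_
  filter_upwards [h1, hgB] with η h2 h3
  have h4 : ∀ Φ : E, inner ℂ (Φ.1 η) (g η) = 0 := by
    have hcl : IsClosed {Φ : E | inner ℂ (Φ.1 η) (g η) = 0} := by
      refine isClosed_eq ?_ continuous_const
      exact ((continuous_eval_const η).comp continuous_subtype_val).inner
        continuous_const
    intro Φ
    exact hcl.closure_subset_iff.2 h2 (hD Φ)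
  have h5 : g η ∈ (bergmanExt ϖ η)ᗮ := by
    rw [Submodule.mem_orthogonal]
    intro v hv
    obtain ⟨f, hf, hfs, hfv⟩ := exists_hasSum_shift_of_mem_bergmanExt h hnull hA hv
    obtain ⟨Φ, hΦ, hΦη⟩ := exists_continuousMap_floquetIsometry h hnull ⟨f, hf⟩ hfs
    have h6 : Φ η = (1 / (2 * Real.pi) : ℂ) • v := by
      rw [hΦη, ← hfv.tsum_eq, ← hfv.summable.tsum_const_smul]
      exact tsum_congr fun m => mul_smul _ _ _
    have h7 := h4 ⟨Φ, _, hΦ⟩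
    rw [h6, inner_smul_left, mul_eq_zero] at h7
    refine h7.resolve_left ?_
    simp [Real.pi_ne_zero]
  rw [← Submodule.orthogonal_closure] at h5
  exact inner_self_eq_zero.1 ((Submodule.mem_orthogonal _ _).1 h5 _ h3.1)

/-- The Floquet transform as an isometry into `L²(𝐐; A²_η(ϖ))`. -/
noncomputable def floquetTransform {ϖ : Set ℂ} (h : IsPeriodicCell ϖ)
    (hnull : volume (periodicDomain ϖ \ ⋃ m : ℤ × ℤ, cellTranslate ϖ m) = 0) :
    bergmanSpace (periodicDomain ϖ) →ₗᵢ[ℂ] bochnerBergman ϖ :=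
  ⟨(floquetIsometry h hnull).toLinearMap.codRestrict _ (floquetIsometry_mem h hnull),
    fun f => (floquetIsometry h hnull).norm_map f⟩

/-- The range is closed, being the isometric image of a complete space. The component of `g`
orthogonal to it still lies in `bochnerBergman ϖ`, hence vanishes. -/
lemma floquetTransform_surjective {ϖ : Set ℂ} (h : IsPeriodicCell ϖ)
    (hnull : volume (periodicDomain ϖ \ ⋃ m : ℤ × ℤ, cellTranslate ϖ m) = 0)
    (hA : ConditionA (periodicDomain ϖ)) : Function.Surjective (floquetTransform h hnull) := by
  intro g
  have : CompleteSpace (bergmanSpace (periodicDomain ϖ)) :=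
    (isClosed_bergmanSpace (isOpen_periodicDomain ϖ)).completeSpace_coe
  set K := (floquetIsometry h hnull).toLinearMap.range
  have hK : IsClosed (K : Set (BochnerL2 ϖ)) :=
    (floquetIsometry h hnull).isometry.isClosedEmbedding.isClosed_range
  have : CompleteSpace K := hK.completeSpace_coe
  have hKB : K ≤ bochnerBergman ϖ := by
    rintro _ ⟨f, rfl⟩
    exact floquetIsometry_mem h hnull f
  have h1 := eq_zero_of_mem_orthogonal h hnull hA
    (sub_mem g.2 (hKB (K.starProjection_apply_mem g)))
    (K.sub_starProjection_mem_orthogonal (g : BochnerL2 ϖ))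
  have h2 : (g : BochnerL2 ϖ) ∈ K := by
    rw [sub_eq_zero.1 h1]
    exact K.starProjection_apply_mem g
  obtain ⟨f, hf⟩ := h2
  exact ⟨f, Subtype.ext hf⟩

/-- Functionals of the translates of `f` are Fourier coefficients of the Floquet transform. -/
lemma apply_shift_eq_integral {ϖ : Set ℂ} (h : IsPeriodicCell ϖ)
    (hnull : volume (periodicDomain ϖ \ ⋃ m : ℤ × ℤ, cellTranslate ϖ m) = 0)
    (f : bergmanSpace (periodicDomain ϖ)) (ℓ : L2 ϖ →L[ℂ] ℂ) (n : ℤ × ℤ) :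
    ℓ (shift h n (f : L2 (periodicDomain ϖ))) = (1 / (2 * Real.pi) : ℂ) *
      ∫ η in floquetBox, exp ((phase η n : ℂ) * I) * ℓ (floquetIsometry h hnull f η) := by
  set a := (InnerProductSpace.toDual ℂ (L2 ϖ)).symm ℓ
  have ha : ∀ x, inner ℂ a x = ℓ x := fun x => InnerProductSpace.toDual_symm_apply
  simp only [← ha]
  rw [← inner_termL_left]
  have h1 : HasSum (fun m => inner ℂ (termL ϖ n a)
      (termL ϖ m (shift h m (f : L2 (periodicDomain ϖ)))))
      (inner ℂ (termL ϖ n a) (floquetIsometry h hnull f)) :=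
    (innerSL ℂ (termL ϖ n a)).hasSum (hasSum_floquetIsometry h hnull f)
  refine HasSum.unique ?_ h1
  have h2 := hasSum_single (f := fun m => inner ℂ (termL ϖ n a)
      (termL ϖ m (shift h m (f : L2 (periodicDomain ϖ))))) n
    fun m hm => orthogonalFamily_termL ϖ hm.symm _ _
  rwa [LinearIsometry.inner_map_map] at h2

end DoublyPeriodic

open DoublyPeriodic
theorem theorem3p2 (ϖ : Set ℂ) (hϖ : IsPeriodicCell ϖ)
    (hnull : volume (periodicDomain ϖ \ ⋃ m : ℤ × ℤ, cellTranslate ϖ m) = 0)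
    (hA : ConditionA (periodicDomain ϖ)) :
    ∃ F : bergmanSpace (periodicDomain ϖ) ≃ₗᵢ[ℂ] bochnerBergman ϖ,
      (∀ f : bergmanSpace (periodicDomain ϖ),
        HasSum (fun m : ℤ × ℤ => floquetTerm hϖ (f : L2 (periodicDomain ϖ)) m)
          (F f : BochnerL2 ϖ)) ∧
      (∀ g : bochnerBergman ϖ, ∀ z ∈ periodicDomain ϖ, z - latticePt (floorIdx z) ∈ ϖ →
        IntegrableOn (fun η : ℝ × ℝ => exp ((phase η (floorIdx z) : ℂ) * I) *
          analyticRep ϖ ((g : BochnerL2 ϖ) η) (z - latticePt (floorIdx z))) floquetBox volume ∧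
        analyticRep (periodicDomain ϖ) (F.symm g : L2 (periodicDomain ϖ)) z =
          (1 / (2 * Real.pi) : ℂ) * ∫ η in floquetBox,
            exp ((phase η (floorIdx z) : ℂ) * I) *
              analyticRep ϖ ((g : BochnerL2 ϖ) η) (z - latticePt (floorIdx z))) := by
  refine ⟨LinearIsometryEquiv.ofSurjective (floquetTransform hϖ hnull)
    (floquetTransform_surjective hϖ hnull hA), fun f => hasSum_floquetIsometry hϖ hnull f,
    fun g z _ hz => ?_⟩
  set F := LinearIsometryEquiv.ofSurjective (floquetTransform hϖ hnull)
    (floquetTransform_surjective hϖ hnull hA)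
  obtain ⟨f, rfl⟩ := F.surjective g
  rw [F.symm_apply_apply]
  change IntegrableOn (fun η : ℝ × ℝ => exp ((phase η (floorIdx z) : ℂ) * I) *
    analyticRep ϖ (floquetIsometry hϖ hnull f η) (z - latticePt (floorIdx z))) floquetBox volume ∧
    analyticRep (periodicDomain ϖ) (f : L2 (periodicDomain ϖ)) z =
      (1 / (2 * Real.pi) : ℂ) * ∫ η in floquetBox, exp ((phase η (floorIdx z) : ℂ) * I) *
        analyticRep ϖ (floquetIsometry hϖ hnull f η) (z - latticePt (floorIdx z))
  set n := floorIdx z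
  set w := z - latticePt n
  obtain ⟨r, hr, hrϖ⟩ := Metric.nhds_basis_closedBall.mem_iff.1 (hϖ.isOpen.mem_nhds hz)
  -- The disc average replaces the representative, chosen separately for each `η`, by a fixed
  -- bounded functional of the fibre; this supplies measurability and integrability.
  have hrep : (fun η => exp ((phase η n : ℂ) * I) *
      ballAvg ϖ w r (floquetIsometry hϖ hnull f η)) =ᵐ[volume.restrict floquetBox]
      fun η => exp ((phase η n : ℂ) * I) * analyticRep ϖ (floquetIsometry hϖ hnull f η) w := by
    filter_upwards [floquetIsometry_mem hϖ hnull f] with η hη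
    rw [ballAvg_eq_analyticRep hr hrϖ hη.2]
  constructor
  · refine Integrable.congr ?_ hrep
    have h1 : Integrable (fun η => ballAvg ϖ w r (floquetIsometry hϖ hnull f η))
        (volume.restrict floquetBox) :=
      (ballAvg ϖ w r).integrable_comp ((Lp.memLp _).integrable (by norm_num))
    refine h1.bdd_mul (c := 1) (Continuous.aestronglyMeasurable ?_)
      (.of_forall fun η => (norm_exp_ofReal_mul_I _).le)
    have := continuous_phase n
    fun_prop
  · rw [← integral_congr_ae hrep, ← apply_shift_eq_integral]
    have hsub : ∀ x ∈ ϖ, x + latticePt n ∈ periodicDomain ϖ := fun x hx =>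
      hϖ.translate_subset n (mem_image_of_mem _ hx)
    have h1 := ballAvg_apply hr hrϖ
      (G := fun x => analyticRep (periodicDomain ϖ) (f : L2 (periodicDomain ϖ)) (x + latticePt n))
      ((differentiableOn_analyticRep f.2).comp (by fun_prop) hsub)
      (translateL_congr hsub (ae_eq_analyticRep f.2))
    rw [shift_eq_translateL, h1, sub_add_cancel]
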